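/- **Notation.** Let $G$ be a finite matrix group acting by conjugation $\mathrm{Ad}(g)X=gXg^{-1}$ on its matrix Lie algebra $\mathcal G$. Let $\mathcal C(\mathcal G)$ be the real vector space of functions $\mathcal G\to\mathbb R$ that are constant on the orbits of this action. For a parabolic subgroup $P=LU$ of $G$ (Levi subgroup $L$, unipotent radical $U$), with Lie algebras $\mathfrak p=\mathfrak l\oplus\mathfrak u$, the *parabolic restriction* $\downarrow^{\mathcal G}_{\mathfrak l}:\mathcal C(\mathcal G)\to\mathcal C(\mathfrak l)$ and the *parabolic induction* $\uparrow^{\mathcal G}_{\mathfrak l}:\mathcal C(\mathfrak l)\to\mathcal C(\mathcal G)$ are the linear maps $$(\downarrow^{\mathcal G}_{\mathfrak l}\Psi)(Y)=\frac1{|\mathfrak u|}\sum_{Z\in\mathfrak u}\Psi(Y+Z),\qquad (\uparrow^{\mathcal G}_{\mathfrak l}\Phi)(X)=\sum_{g\in[G/P]}\Phi'(g^{-1}Xg),$$ where $[G/P]$ is any set of representatives of the left cosets of $P$ in $G$, and $\Phi':\mathcal G\to\mathbb R$ is $\Phi$ composed with the projection $\mathfrak l\oplus\mathfrak u\to\mathfrak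 l$ on $\mathfrak p$, and $0$ on $\mathcal G\setminus\mathfrak p$. **Setting I.** $G=\mathrm{GL}(n,\mathbb F_q)$, $\mathcal G=\mathfrak{gl}(n,\mathbb F_q)$. The parabolics considered are, for $i,j\ge 0$ with $i+j=n$, the groups $P_{i,j}=L_{i,j}U_{i,j}$ of block upper triangular matrices with respect to $n=i+j$; $L_{i,j}$ consists of the invertible block diagonal matrices, $U_{i,j}$ of the block upper triangular matrices with identity diagonal blocks. **Setting II.** $q$ is odd, $A^*=(a_{ts}^q)_{s,t}$ for a matrix $A=(a_{st})$ over $\mathbb F_{q^2}$, and $J_m$ is the $m\times m$ matrix with ones on the antidiagonal and zeros elsewhere. $G=\mathrm U(2n,\mathbb F_{q^2})=\{g\in \mathrm{GL}(2n,\mathbb F_{q^2}): g^*J_{2n}g=J_{2n}\}$, $\mathcal G=\mathfrak u(2n,\mathbb F_{q^2})=\{X:X^*J_{2n}+J_{2n}X=0\}$. The parabolics considered are, for $i,j\ge0$ with $i+j=n$, the groups $\widetilde P_{i,j}=\widetilde L_{i,j}\widetilde U_{i,j}$ of the matrices in $G$ that are block upper triangular with respect to $2n=i+2j+i$; $\widetilde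 L_{i,j}$ consists of the block diagonal matrices in $G$, that is $\mathrm{diag}(A,B,J_i(A^*)^{-1}J_i)$ with $A\in\mathrm{GL}(i,\mathbb F_{q^2})$, $B\in\mathrm U(2j,\mathbb F_{q^2})$, and $\widetilde U_{i,j}$ of the block upper triangular matrices in $G$ with identity diagonal blocks. In both settings the Lie algebra of such an $L$ consists of the block diagonal matrices in $\mathcal G$, that of $U$ of the block upper triangular matrices in $\mathcal G$ with zero diagonal blocks. Let $W$ be the Weyl group of $G$, realized as the group of permutation matrices lying in $G$. **Theorem (Mackey's theorem for invariant functions on Lie algebras).** In Setting I or in Setting II, let $P=LU$ and $P'=L'U'$ be two of the parabolics considered, with Lie algebras $\mathfrak l,\mathfrak u,\mathfrak l',\mathfrak u'$ of $L,U,L',U'$. For $w\in W$ put $$L_w=L\cap w^{-1}L'w,\quad U_w=L\cap w^{-1}U'w,\quad L'_w=L'\cap wLw^{-1},\quad U'_w=L'\cap wUw^{-1},$$ $$\mathfrak l_w=\mathfrak l\cap w^{-1}\mathfrak l'w,\quad \mathfrak u_w=\mathfrak l\cap w^{-1}\mathfrak u'w,\quad \mathfrak l'_w=\mathfrak l'\cap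 w\mathfrak lw^{-1},\quad \mathfrak u'_w=\mathfrak l'\cap w\mathfrak uw^{-1}.$$ Let $\downarrow^{\mathfrak l}_{\mathfrak l_w}:\mathcal C(\mathfrak l)\to\mathcal C(\mathfrak l_w)$ and $\uparrow^{\mathfrak l'}_{\mathfrak l'_w}:\mathcal C(\mathfrak l'_w)\to\mathcal C(\mathfrak l')$ be the parabolic restriction and induction for the parabolics $L_wU_w$ of $L$ and $L'_wU'_w$ of $L'$, and let $T_w:\mathcal C(\mathfrak l_w)\to\mathcal C(\mathfrak l'_w)$ be the linear isomorphism $(T_wf)(X)=f(w^{-1}Xw)$. Then the following identity of linear maps $\mathcal C(\mathfrak l)\to\mathcal C(\mathfrak l')$ holds: $$\downarrow^{\mathcal G}_{\mathfrak l'}\circ\uparrow^{\mathcal G}_{\mathfrak l}=\sum_{w\in[(W\cap L')\backslash W/(W\cap L)]}\uparrow^{\mathfrak l'}_{\mathfrak l'_w}\circ T_w\circ\downarrow^{\mathfrak l}_{\mathfrak l_w},$$ where $w$ ranges over any set of representatives of the double cosets $(W\cap L')\backslash W/(W\cap L)$. -/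

import Mathlib

open scoped Matrix MatrixGroups

noncomputable section

namespace MackeyLie

attribute [local instance] LieRing.ofAssociativeRing

section General

variable {k K : Type*} [Field k] [Field K] [Algebra k K] {m : ℕ}

/-- The adjoint action `Ad(g) X = g X g⁻¹` of an invertible matrix on the Lie algebra of all
`m × m` matrices over `K`, as a homomorphism of Lie algebras over `k`. -/
def Ad (k : Type*) {K : Type*} [Field k] [Field K] [Algebra k K] {m : ℕ} (g : GL (Fin m) K) :
    Matrix (Fin m) (Fin m) K →ₗ⁅k⁆ Matrix (Fin m) (Fin m) K where
  toFun X := g.val * X * g⁻¹.val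
  map_add' X Y := by simp [mul_add, add_mul]
  map_smul' c X := by simp
  map_lie' {X Y} := by
    have h : g⁻¹.val * g.val = 1 := by rw [← Units.val_mul]; simp
    have e : ∀ A B : Matrix (Fin m) (Fin m) K,
        (g.val * A * g⁻¹.val) * (g.val * B * g⁻¹.val) = g.val * (A * B) * g⁻¹.val := by
      intro A B
      calc _ = g.val * A * (g⁻¹.val * g.val) * (B * g⁻¹.val) := by simp only [mul_assoc]
        _ = _ := by rw [h]; simp only [mul_assoc, one_mul]
    simp only [LieRing.of_associative_ring_bracket, e, mul_sub, sub_mul]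

theorem Ad_apply (g : GL (Fin m) K) (X : Matrix (Fin m) (Fin m) K) :
    Ad k g X = g.val * X * g⁻¹.val := rfl

theorem Ad_mul (g h : GL (Fin m) K) (X : Matrix (Fin m) (Fin m) K) :
    Ad k (g * h) X = Ad k g (Ad k h X) := by
  simp only [Ad_apply, mul_inv_rev, Units.val_mul, mul_assoc]

theorem Ad_one (X : Matrix (Fin m) (Fin m) K) : Ad k (1 : GL (Fin m) K) X = X := by
  simp [Ad_apply]

theorem Ad_inv_Ad (g : GL (Fin m) K) (X : Matrix (Fin m) (Fin m) K) :
    Ad k g⁻¹ (Ad k g X) = X := by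
  rw [← Ad_mul, inv_mul_cancel, Ad_one]

theorem Ad_Ad_inv (g : GL (Fin m) K) (X : Matrix (Fin m) (Fin m) K) :
    Ad k g (Ad k g⁻¹ X) = X := by
  rw [← Ad_mul, mul_inv_cancel, Ad_one]

/-- A matrix group over `K` together with a matrix Lie algebra over `k` on which it acts by the
adjoint action. -/
structure LiePair (k K : Type*) [Field k] [Field K] [Algebra k K] (m : ℕ) where
  grp : Subgroup (GL (Fin m) K)
  lie : LieSubalgebra k (Matrix (Fin m) (Fin m) K)
  ad_mem : ∀ g ∈ grp, ∀ X ∈ lie, Ad k g X ∈ lie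

namespace LiePair

variable (G : LiePair k K m)

/-- The adjoint action of an element of the group on the Lie algebra. -/
def adj (g : G.grp) (X : G.lie) : G.lie := ⟨Ad k g.1 X.1, G.ad_mem g.1 g.2 X.1 X.2⟩

/-- The real vector space of invariant functions on the Lie algebra. -/
def Inv : Submodule ℝ (G.lie → ℝ) where
  carrier := {f | ∀ (g : G.grp) (X : G.lie), f (G.adj g X) = f X}
  add_mem' := by
    intro a b ha hb g X
    simp [ha g X, hb g X]
  zero_mem' := by
    intro g X
    rfl
  smul_mem' := by
    intro c f hf g X
    simp [hf g X]

end LiePair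

/-- A parabolic subgroup `P = L U` of `G` given through its Levi decomposition: the Levi subgroup
`L` with its Lie algebra `𝔩` (`levi`), and the unipotent radical `U` (`unip`) with its Lie algebra
`𝔲` (`nil`). -/
structure Parabolic (G : LiePair k K m) where
  levi : LiePair k K m
  unip : Subgroup (GL (Fin m) K)
  nil : LieSubalgebra k (Matrix (Fin m) (Fin m) K)
  levi_le : levi.grp ≤ G.grp
  unip_le : unip ≤ G.grp
  levi_lie_le : levi.lie ≤ G.lie
  nil_le : nil ≤ G.lie
  normal : ∀ l ∈ levi.grp, ∀ u ∈ unip, l * u * l⁻¹ ∈ unip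
  ideal : ∀ Y ∈ levi.lie, ∀ Z ∈ nil, ⁅Y, Z⁆ ∈ nil
  ad_nil : ∀ l ∈ levi.grp, ∀ Z ∈ nil, Ad k l Z ∈ nil
  inf_grp : ∀ g ∈ levi.grp, g ∈ unip → g = 1
  inf_lie : ∀ X ∈ levi.lie, X ∈ nil → X = 0
  ad_unip : ∀ u ∈ unip, ∀ Y ∈ levi.lie, ∀ Z ∈ nil, Ad k u (Y + Z) - Y ∈ nil

namespace Parabolic

variable {G : LiePair k K m} (D : Parabolic G)

/-- The parabolic subgroup `P = L U`. -/
def P : Subgroup (GL (Fin m) K) := D.levi.grp ⊔ D.unip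

/-- The Lie algebra `𝔭 = 𝔩 ⊕ 𝔲` of the parabolic subgroup, as a vector space. -/
def parLie : Submodule k (Matrix (Fin m) (Fin m) K) := D.levi.lie.toSubmodule ⊔ D.nil.toSubmodule

theorem exists_proj (X : D.parLie) : ∃ Y : D.levi.lie, X.1 - Y.1 ∈ D.nil := by
  obtain ⟨Y, hY, Z, hZ, h⟩ := Submodule.mem_sup.1 X.2
  refine ⟨⟨Y, hY⟩, ?_⟩
  rw [← h]
  simpa using hZ

/-- The projection of `𝔭 = 𝔩 ⊕ 𝔲` onto the first summand. -/
def proj (X : D.parLie) : D.levi.lie := (D.exists_proj X).choose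

theorem sub_proj_mem (X : D.parLie) : X.1 - (D.proj X).1 ∈ D.nil := (D.exists_proj X).choose_spec

theorem proj_eq (X : D.parLie) (Y : D.levi.lie) (h : X.1 - Y.1 ∈ D.nil) : D.proj X = Y := by
  have h1 := D.nil.sub_mem h (D.sub_proj_mem X)
  have h2 : (D.proj X).1 - Y.1 ∈ D.nil := by simpa using h1
  have h3 := D.inf_lie _ (D.levi.lie.sub_mem (D.proj X).2 Y.2) h2
  exact Subtype.ext (sub_eq_zero.1 h3)

theorem mem_parLie {X Y : Matrix (Fin m) (Fin m) K} (hY : Y ∈ D.levi.lie) (h : X - Y ∈ D.nil) :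
    X ∈ D.parLie :=
  Submodule.mem_sup.2 ⟨Y, hY, X - Y, h, by abel⟩

open Classical in
/-- The function `Φ'` on the space of matrices: `Φ ∘ proj` on `𝔭`, and `0` outside `𝔭`. -/
def extend (Φ : D.levi.lie → ℝ) (X : Matrix (Fin m) (Fin m) K) : ℝ :=
  if h : X ∈ D.parLie then Φ (D.proj ⟨X, h⟩) else 0

theorem extend_eq (Φ : D.levi.lie → ℝ) (X : Matrix (Fin m) (Fin m) K) (Y : D.levi.lie)
    (h : X - Y.1 ∈ D.nil) : D.extend Φ X = Φ Y := by
  have hX := D.mem_parLie Y.2 h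
  unfold extend
  rw [dif_pos hX, D.proj_eq ⟨X, hX⟩ Y h]

theorem extend_eq_zero (Φ : D.levi.lie → ℝ) (X : Matrix (Fin m) (Fin m) K)
    (h : X ∉ D.parLie) : D.extend Φ X = 0 := by
  unfold extend
  rw [dif_neg h]

theorem extend_eq_of_sub (Φ : D.levi.Inv) (p : GL (Fin m) K)
    (hp : ∀ Y : D.levi.lie, ∃ Y' : D.levi.lie, Φ.1 Y' = Φ.1 Y ∧
      ∀ Z ∈ D.nil, Ad k p (Y.1 + Z) - Y'.1 ∈ D.nil)
    (hp' : ∀ Y : D.levi.lie, ∃ Y' : D.levi.lie, ∀ Z ∈ D.nil, Ad k p⁻¹ (Y.1 + Z) - Y'.1 ∈ D.nil)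
    (X : Matrix (Fin m) (Fin m) K) : D.extend Φ.1 (Ad k p X) = D.extend Φ.1 X := by
  by_cases h : X ∈ D.parLie
  · obtain ⟨Y, hY⟩ := D.exists_proj ⟨X, h⟩
    obtain ⟨Y', h1, h2⟩ := hp Y
    have h3 := h2 _ hY
    rw [add_sub_cancel] at h3
    rw [D.extend_eq Φ.1 X Y hY, D.extend_eq Φ.1 _ Y' h3, h1]
  · rw [D.extend_eq_zero _ _ h, D.extend_eq_zero]
    intro h'
    apply h
    obtain ⟨Y, hY⟩ := D.exists_proj ⟨_, h'⟩
    obtain ⟨Y', h2⟩ := hp' Y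
    have h3 := h2 _ hY
    rw [add_sub_cancel] at h3
    rw [Ad_inv_Ad] at h3
    exact D.mem_parLie Y'.2 h3

theorem extend_levi (Φ : D.levi.Inv) (l : GL (Fin m) K) (hl : l ∈ D.levi.grp)
    (X : Matrix (Fin m) (Fin m) K) : D.extend Φ.1 (Ad k l X) = D.extend Φ.1 X := by
  refine D.extend_eq_of_sub Φ l (fun Y => ?_) (fun Y => ?_) X
  · refine ⟨D.levi.adj ⟨l, hl⟩ Y, Φ.2 ⟨l, hl⟩ Y, fun Z hZ => ?_⟩
    rw [map_add]
    simpa [LiePair.adj] using D.ad_nil l hl Z hZ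
  · refine ⟨D.levi.adj ⟨l⁻¹, inv_mem hl⟩ Y, fun Z hZ => ?_⟩
    rw [map_add]
    simpa [LiePair.adj] using D.ad_nil _ (inv_mem hl) Z hZ

theorem extend_unip (Φ : D.levi.Inv) (u : GL (Fin m) K) (hu : u ∈ D.unip)
    (X : Matrix (Fin m) (Fin m) K) : D.extend Φ.1 (Ad k u X) = D.extend Φ.1 X :=
  D.extend_eq_of_sub Φ u (fun Y => ⟨Y, rfl, fun Z hZ => D.ad_unip u hu Y.1 Y.2 Z hZ⟩)
    (fun Y => ⟨Y, fun Z hZ => D.ad_unip u⁻¹ (inv_mem hu) Y.1 Y.2 Z hZ⟩) X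

theorem extend_P (Φ : D.levi.Inv) (p : GL (Fin m) K) (hp : p ∈ D.P)
    (X : Matrix (Fin m) (Fin m) K) : D.extend Φ.1 (Ad k p X) = D.extend Φ.1 X := by
  have h : D.P ≤
      { carrier := {p | ∀ X : Matrix (Fin m) (Fin m) K, D.extend Φ.1 (Ad k p X) = D.extend Φ.1 X}
        mul_mem' := by
          intro a b ha hb X
          rw [Ad_mul, ha, hb]
        one_mem' := by
          intro X
          rw [Ad_one]
        inv_mem' := by
          intro a ha X
          rw [← ha (Ad k a⁻¹ X), Ad_Ad_inv] } :=
    sup_le (fun l hl => D.extend_levi Φ l hl) (fun u hu => D.extend_unip Φ u hu)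
  exact h hp X

/-- The summand `Φ'(Ad(g⁻¹) X)` of parabolic induction, as a function of the left coset `g P`. -/
def indTerm (Φ : D.levi.Inv) (X : Matrix (Fin m) (Fin m) K)
    (c : G.grp ⧸ D.P.subgroupOf G.grp) : ℝ :=
  Quotient.liftOn' c (fun g => D.extend Φ.1 (Ad k g.1⁻¹ X)) (by
    intro a b hab
    rw [QuotientGroup.leftRel_apply] at hab
    have h : (a.1⁻¹ * b.1) ∈ D.P := hab
    have e : a.1⁻¹ = (a.1⁻¹ * b.1) * b.1⁻¹ := by group
    show D.extend Φ.1 (Ad k a.1⁻¹ X) = D.extend Φ.1 (Ad k b.1⁻¹ X)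
    rw [e, Ad_mul, D.extend_P Φ _ h])

theorem indTerm_adj (Φ : D.levi.Inv) (g : G.grp) (X : Matrix (Fin m) (Fin m) K)
    (c : G.grp ⧸ D.P.subgroupOf G.grp) :
    D.indTerm Φ (Ad k g.1 X) c = D.indTerm Φ X (g⁻¹ • c) := by
  induction c using Quotient.inductionOn' with
  | h a =>
    change D.extend Φ.1 (Ad k a.1⁻¹ (Ad k g.1 X)) = D.extend Φ.1 (Ad k (g⁻¹ * a).1⁻¹ X)
    rw [← Ad_mul]
    simp

theorem indTerm_add (Φ Ψ : D.levi.Inv) (X : Matrix (Fin m) (Fin m) K)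
    (c : G.grp ⧸ D.P.subgroupOf G.grp) :
    D.indTerm (Φ + Ψ) X c = D.indTerm Φ X c + D.indTerm Ψ X c := by
  induction c using Quotient.inductionOn' with
  | h a =>
    change D.extend (Φ.1 + Ψ.1) _ = D.extend Φ.1 _ + D.extend Ψ.1 _
    unfold extend
    split <;> simp

theorem indTerm_smul (r : ℝ) (Φ : D.levi.Inv) (X : Matrix (Fin m) (Fin m) K)
    (c : G.grp ⧸ D.P.subgroupOf G.grp) :
    D.indTerm (r • Φ) X c = r * D.indTerm Φ X c := by
  induction c using Quotient.inductionOn' with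
  | h a =>
    change D.extend (r • Φ.1) _ = r * D.extend Φ.1 _
    unfold extend
    split <;> simp

/-- The bijection `Z ↦ Ad(l) Z` of `𝔲`, for `l` in the Levi subgroup. -/
def nilEquiv (l : D.levi.grp) : D.nil ≃ D.nil where
  toFun Z := ⟨Ad k l.1 Z.1, D.ad_nil _ l.2 _ Z.2⟩
  invFun Z := ⟨Ad k l.1⁻¹ Z.1, D.ad_nil _ (inv_mem l.2) _ Z.2⟩
  left_inv _ := Subtype.ext (Ad_inv_Ad _ _)
  right_inv _ := Subtype.ext (Ad_Ad_inv _ _)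

/-- Parabolic restriction `𝒞(𝔤) → 𝒞(𝔩)`: the average over `𝔲` of the values `Ψ(Y + Z)`. -/
def res [Finite K] : G.Inv →ₗ[ℝ] D.levi.Inv where
  toFun Ψ := ⟨fun Y => (Nat.card D.nil : ℝ)⁻¹ * ∑ᶠ Z : D.nil,
      Ψ.1 (⟨Y.1, D.levi_lie_le Y.2⟩ + ⟨Z.1, D.nil_le Z.2⟩), by
    intro l Y
    dsimp only
    congr 1
    rw [← finsum_comp_equiv (D.nilEquiv l)]
    refine finsum_congr fun Z => ?_
    rw [← Ψ.2 ⟨l.1, D.levi_le l.2⟩ (⟨Y.1, D.levi_lie_le Y.2⟩ + ⟨Z.1, D.nil_le Z.2⟩)]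
    exact congrArg Ψ.1 (Subtype.ext (map_add (Ad k l.1) Y.1 Z.1).symm)⟩
  map_add' := by
    intro Φ Ψ
    refine Subtype.ext (funext fun Y => ?_)
    change _ * ∑ᶠ Z : D.nil, (Φ.1 _ + Ψ.1 _) = _ * _ + _ * _
    rw [finsum_add_distrib (Set.toFinite _) (Set.toFinite _), mul_add]
  map_smul' := by
    intro r Φ
    refine Subtype.ext (funext fun Y => ?_)
    change _ * ∑ᶠ Z : D.nil, (r * Φ.1 _) = r * (_ * _)
    rw [← mul_finsum, mul_left_comm]

/-- Parabolic induction `𝒞(𝔩) → 𝒞(𝔤)`; the sum runs over the left cosets of `G` modulo `P`. -/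
def ind [Finite K] : D.levi.Inv →ₗ[ℝ] G.Inv where
  toFun Φ := ⟨fun X => ∑ᶠ c : G.grp ⧸ D.P.subgroupOf G.grp, D.indTerm Φ X.1 c, by
    intro g X
    exact (finsum_congr fun c => D.indTerm_adj Φ g X.1 c).trans
      (finsum_comp_equiv (f := fun c => D.indTerm Φ X.1 c)
        (MulAction.toPerm g⁻¹ : Equiv.Perm (G.grp ⧸ D.P.subgroupOf G.grp)))⟩
  map_add' := by
    intro Φ Ψ
    refine Subtype.ext (funext fun X => ?_)
    change ∑ᶠ c, D.indTerm (Φ + Ψ) X.1 c = ∑ᶠ c, D.indTerm Φ X.1 c + ∑ᶠ c, D.indTerm Ψ X.1 c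
    rw [← finsum_add_distrib (Set.toFinite _) (Set.toFinite _)]
    exact finsum_congr fun c => D.indTerm_add Φ Ψ X.1 c
  map_smul' := by
    intro r Φ
    refine Subtype.ext (funext fun X => ?_)
    change ∑ᶠ c, D.indTerm (r • Φ) X.1 c = r * ∑ᶠ c, D.indTerm Φ X.1 c
    rw [mul_finsum]
    exact finsum_congr fun c => D.indTerm_smul r Φ X.1 c

theorem Ad_conj (w g : GL (Fin m) K) (X : Matrix (Fin m) (Fin m) K) :
    Ad k w (Ad k g X) = Ad k (MulAut.conj w g) (Ad k w X) := by
  rw [← Ad_mul, ← Ad_mul]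
  simp [MulAut.conj_apply]

/-- For two parabolics `P = L U` and `P' = L' U'` of `G` and a matrix `w`, the parabolic of `L`
with Levi subgroup `L ∩ w⁻¹ L' w` and unipotent radical `L ∩ w⁻¹ U' w`, whose Lie algebras are
`𝔩 ∩ w⁻¹ 𝔩' w` and `𝔩 ∩ w⁻¹ 𝔲' w`. -/
def rel (D' : Parabolic G) (w : GL (Fin m) K) : Parabolic D.levi where
  levi :=
    { grp := D.levi.grp ⊓ D'.levi.grp.comap (MulAut.conj w).toMonoidHom
      lie := D.levi.lie ⊓ D'.levi.lie.comap (Ad k w)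
      ad_mem := by
        rintro g ⟨h1, h2⟩ X ⟨h3, h4⟩
        refine ⟨D.levi.ad_mem g h1 X h3, ?_⟩
        have h := D'.levi.ad_mem _ h2 _ h4
        change Ad k w (Ad k g X) ∈ D'.levi.lie
        rw [Ad_conj]
        exact h }
  unip := D.levi.grp ⊓ D'.unip.comap (MulAut.conj w).toMonoidHom
  nil := D.levi.lie ⊓ D'.nil.comap (Ad k w)
  levi_le := inf_le_left
  unip_le := inf_le_left
  levi_lie_le := inf_le_left
  nil_le := inf_le_left
  normal := by
    rintro l ⟨h1, h2⟩ u ⟨h3, h4⟩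
    refine ⟨D.levi.grp.mul_mem (D.levi.grp.mul_mem h1 h3) (D.levi.grp.inv_mem h1), ?_⟩
    have h := D'.normal _ h2 _ h4
    rw [← map_inv, ← map_mul, ← map_mul] at h
    exact h
  ideal := by
    rintro Y ⟨h1, h2⟩ Z ⟨h3, h4⟩
    refine ⟨D.levi.lie.lie_mem h1 h3, ?_⟩
    have h := D'.ideal _ h2 _ h4
    change Ad k w ⁅Y, Z⁆ ∈ D'.nil
    rw [LieHom.map_lie]
    exact h
  ad_nil := by
    rintro l ⟨h1, h2⟩ Z ⟨h3, h4⟩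
    refine ⟨D.levi.ad_mem l h1 Z h3, ?_⟩
    have h := D'.ad_nil _ h2 _ h4
    change Ad k w (Ad k l Z) ∈ D'.nil
    rw [Ad_conj]
    exact h
  inf_grp := by
    rintro g ⟨_, h2⟩ ⟨_, h4⟩
    exact (MulAut.conj w).injective ((D'.inf_grp _ h2 h4).trans (map_one _).symm)
  inf_lie := by
    rintro X ⟨_, h2⟩ ⟨_, h4⟩
    have h := D'.inf_lie _ h2 h4
    rw [← Ad_inv_Ad (k := k) w X]
    exact (congrArg (Ad k w⁻¹) h).trans (map_zero _)
  ad_unip := by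
    rintro u ⟨h1, h2⟩ Y ⟨h3, h4⟩ Z ⟨h5, h6⟩
    refine ⟨D.levi.lie.sub_mem (D.levi.ad_mem u h1 _ (D.levi.lie.add_mem h3 h5)) h3, ?_⟩
    have h := D'.ad_unip _ h2 _ h4 _ h6
    have e : Ad k w (Ad k u (Y + Z) - Y) =
        Ad k (MulAut.conj w u) (Ad k w Y + Ad k w Z) - Ad k w Y := by
      rw [map_sub, Ad_conj, map_add (Ad k w)]
    change Ad k w (Ad k u (Y + Z) - Y) ∈ D'.nil
    rw [e]
    exact h

/-- The linear isomorphism `T_w : 𝒞(𝔩_w) → 𝒞(𝔩'_w)`, `(T_w f)(X) = f (w⁻¹ X w)`, where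
`𝔩_w = 𝔩 ∩ w⁻¹ 𝔩' w` and `𝔩'_w = 𝔩' ∩ w 𝔩 w⁻¹`. -/
def T (D' : Parabolic G) (w : GL (Fin m) K) :
    (D.rel D' w).levi.Inv ≃ₗ[ℝ] (D'.rel D w⁻¹).levi.Inv where
  toFun f := ⟨fun X => f.1 ⟨Ad k w⁻¹ X.1, by
    obtain ⟨X, h1, h2⟩ := X
    refine ⟨h2, ?_⟩
    change Ad k w (Ad k w⁻¹ X) ∈ D'.levi.lie
    rw [Ad_Ad_inv]
    exact h1⟩, by
    rintro ⟨g, h1, h2⟩ X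
    have h3 : MulAut.conj w⁻¹ g ∈ (D.rel D' w).levi.grp := by
      refine ⟨h2, ?_⟩
      change MulAut.conj w (MulAut.conj w⁻¹ g) ∈ D'.levi.grp
      have e : MulAut.conj w (MulAut.conj w⁻¹ g) = g := by simp [MulAut.conj_apply, mul_assoc]
      rw [e]
      exact h1
    refine Eq.trans (congrArg f.1 (Subtype.ext ?_)) (f.2 ⟨_, h3⟩ _)
    exact Ad_conj w⁻¹ g X.1⟩
  invFun f := ⟨fun X => f.1 ⟨Ad k w X.1, by
    obtain ⟨X, h1, h2⟩ := X
    refine ⟨h2, ?_⟩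
    change Ad k w⁻¹ (Ad k w X) ∈ D.levi.lie
    rw [Ad_inv_Ad]
    exact h1⟩, by
    rintro ⟨g, h1, h2⟩ X
    have h3 : MulAut.conj w g ∈ (D'.rel D w⁻¹).levi.grp := by
      refine ⟨h2, ?_⟩
      change MulAut.conj w⁻¹ (MulAut.conj w g) ∈ D.levi.grp
      have e : MulAut.conj w⁻¹ (MulAut.conj w g) = g := by simp [MulAut.conj_apply, mul_assoc]
      rw [e]
      exact h1
    refine Eq.trans (congrArg f.1 (Subtype.ext ?_)) (f.2 ⟨_, h3⟩ _)
    exact Ad_conj w g X.1⟩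
  map_add' _ _ := rfl
  map_smul' _ _ := rfl
  left_inv f := by
    refine Subtype.ext (funext fun X => ?_)
    exact congrArg f.1 (Subtype.ext (Ad_inv_Ad _ _))
  right_inv f := by
    refine Subtype.ext (funext fun X => ?_)
    exact congrArg f.1 (Subtype.ext (Ad_Ad_inv _ _))

end Parabolic

/-- The group of those permutation matrices that lie in `G`. -/
def weyl (G : LiePair k K m) : Subgroup (GL (Fin m) K) where
  carrier := {g | g ∈ G.grp ∧ ∃ σ : Equiv.Perm (Fin m), g.val = σ.permMatrix K}
  mul_mem' := by
    rintro a b ⟨ha, σ, hσ⟩ ⟨hb, τ, hτ⟩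
    exact ⟨mul_mem ha hb, τ * σ, by rw [Units.val_mul, hσ, hτ, Matrix.permMatrix_mul]⟩
  one_mem' := ⟨one_mem _, 1, by simp⟩
  inv_mem' := by
    rintro a ⟨ha, σ, hσ⟩
    refine ⟨inv_mem ha, σ⁻¹, ?_⟩
    have h : a.val * (σ⁻¹).permMatrix K = 1 := by
      rw [hσ, ← Matrix.permMatrix_mul]; simp
    exact Units.inv_eq_of_mul_eq_one_right h

/-- `R` is a set of representatives of the double cosets `A \ W / B`. -/
def IsDoubleCosetReps {Γ : Type*} [Group Γ] (W A B : Subgroup Γ) (R : Finset Γ) : Prop :=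
  (∀ r ∈ R, r ∈ W) ∧ ∀ w ∈ W, ∃! r, r ∈ R ∧ r ∈ DoubleCoset.doubleCoset w (A : Set Γ) (B : Set Γ)

section Block

variable {β : Fin m → ℕ} {X Y : Matrix (Fin m) (Fin m) K}

theorem diag_triangular (h : ∀ a b, β a ≠ β b → X a b = 0) : X.BlockTriangular β :=
  fun a b hab => h a b hab.ne'

theorem strict_triangular (h : ∀ a b, β b ≤ β a → X a b = 0) : X.BlockTriangular β :=
  fun a b hab => h a b hab.le

theorem diag_mul (hX : ∀ a b, β a ≠ β b → X a b = 0) (hY : ∀ a b, β a ≠ β b → Y a b = 0) :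
    ∀ a b, β a ≠ β b → (X * Y) a b = 0 := by
  intro a b hab
  rw [Matrix.mul_apply]
  refine Finset.sum_eq_zero fun c _ => ?_
  by_cases h : β a = β c
  · rw [hY c b (h ▸ hab), mul_zero]
  · rw [hX a c h, zero_mul]

theorem strict_mul (hX : ∀ a b, β b ≤ β a → X a b = 0) (hY : Y.BlockTriangular β) :
    ∀ a b, β b ≤ β a → (X * Y) a b = 0 := by
  intro a b hab
  rw [Matrix.mul_apply]
  refine Finset.sum_eq_zero fun c _ => ?_
  by_cases h : β c ≤ β a
  · rw [hX a c h, zero_mul]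
  · rw [hY (show β b < β c by omega), mul_zero]

theorem mul_strict (hX : X.BlockTriangular β) (hY : ∀ a b, β b ≤ β a → Y a b = 0) :
    ∀ a b, β b ≤ β a → (X * Y) a b = 0 := by
  intro a b hab
  rw [Matrix.mul_apply]
  refine Finset.sum_eq_zero fun c _ => ?_
  by_cases h : β b ≤ β c
  · rw [hY c b h, mul_zero]
  · rw [hX (show β c < β a by omega), zero_mul]

theorem inv_triangular {α : Type*} [LinearOrder α] {γ : Fin m → α} (g : GL (Fin m) K)
    (h : g.val.BlockTriangular γ) : g⁻¹.val.BlockTriangular γ := by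
  have : Invertible g.val := Units.invertible g
  rw [Matrix.coe_units_inv]
  exact Matrix.blockTriangular_inv_of_blockTriangular h

theorem diag_inv (g : GL (Fin m) K) (h : ∀ a b, β a ≠ β b → g.val a b = 0) :
    ∀ a b, β a ≠ β b → g⁻¹.val a b = 0 := by
  intro a b hab
  rcases lt_or_gt_of_ne hab with h' | h'
  · exact inv_triangular (γ := fun a => OrderDual.toDual (β a)) g
      (fun a b hab => h a b (ne_of_lt (OrderDual.toDual_lt_toDual.1 hab))) h'
  · exact inv_triangular g (diag_triangular h) h'

theorem unip_iff : (∀ a b, β b ≤ β a → X a b = (1 : Matrix (Fin m) (Fin m) K) a b) ↔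
    ∀ a b, β b ≤ β a → (X - 1) a b = 0 := by
  simp only [Matrix.sub_apply, sub_eq_zero]

theorem unip_triangular (h : ∀ a b, β b ≤ β a → (X - 1) a b = 0) : X.BlockTriangular β := by
  have := (strict_triangular h).add (Matrix.blockTriangular_one (b := β))
  simpa using this

theorem unip_inv (g : GL (Fin m) K) (h : ∀ a b, β b ≤ β a → (g.val - 1) a b = 0) :
    ∀ a b, β b ≤ β a → (g⁻¹.val - 1) a b = 0 := by
  have e : g⁻¹.val - 1 = -(g⁻¹.val * (g.val - 1)) := by
    rw [mul_sub, ← Units.val_mul, inv_mul_cancel]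
    simp
  intro a b hab
  rw [e, Matrix.neg_apply, mul_strict (inv_triangular g (unip_triangular h)) h a b hab, neg_zero]

end Block

/-- The parabolic of block upper triangular matrices in `G`, where the rows and columns are
partitioned by the block number `β`: its Levi subgroup consists of the block diagonal matrices
in `G`, and its unipotent radical of the block upper triangular matrices in `G` whose diagonal
blocks are identity matrices. Likewise for the Lie algebras, with zero diagonal blocks
for the nilpotent part. -/
def blockParabolic (G : LiePair k K m) (β : Fin m → ℕ) : Parabolic G where
  levi :=
    { grp :=
        { carrier := {g | g ∈ G.grp ∧ ∀ a b, β a ≠ β b → g.val a b = 0}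
          mul_mem' := fun h1 h2 => ⟨mul_mem h1.1 h2.1, diag_mul h1.2 h2.2⟩
          one_mem' := ⟨one_mem _, fun a b hab => Matrix.one_apply_ne (fun h => hab (h ▸ rfl))⟩
          inv_mem' := fun h => ⟨inv_mem h.1, diag_inv _ h.2⟩ }
      lie :=
        { carrier := {X | X ∈ G.lie ∧ ∀ a b, β a ≠ β b → X a b = 0}
          add_mem' := fun h1 h2 => ⟨add_mem h1.1 h2.1, fun a b hab => by
            rw [Matrix.add_apply, h1.2 a b hab, h2.2 a b hab, add_zero]⟩
          zero_mem' := ⟨zero_mem _, fun _ _ _ => rfl⟩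
          smul_mem' := fun c X h => ⟨G.lie.smul_mem c h.1, fun a b hab => by
            rw [Matrix.smul_apply, h.2 a b hab, smul_zero]⟩
          lie_mem' := fun h1 h2 => ⟨G.lie.lie_mem h1.1 h2.1, fun a b hab => by
            rw [LieRing.of_associative_ring_bracket, Matrix.sub_apply, diag_mul h1.2 h2.2 a b hab,
              diag_mul h2.2 h1.2 a b hab, sub_zero]⟩ }
      ad_mem := fun g hg X hX => ⟨G.ad_mem g hg.1 X hX.1,
        diag_mul (diag_mul hg.2 hX.2) (diag_inv g hg.2)⟩ }
  unip :=
    { carrier := {g | g ∈ G.grp ∧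
        ∀ a b, β b ≤ β a → g.val a b = (1 : Matrix (Fin m) (Fin m) K) a b}
      mul_mem' := by
        rintro g h ⟨hg, hg'⟩ ⟨hh, hh'⟩
        refine ⟨mul_mem hg hh, unip_iff.2 fun a b hab => ?_⟩
        have e : (g * h).val - 1 = (g.val - 1) * h.val + (h.val - 1) := by
          rw [Units.val_mul]; noncomm_ring
        rw [e, Matrix.add_apply, unip_iff.1 hh' a b hab,
          strict_mul (unip_iff.1 hg') (unip_triangular (unip_iff.1 hh')) a b hab, add_zero]
      one_mem' := ⟨one_mem _, fun _ _ _ => rfl⟩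
      inv_mem' := fun h => ⟨inv_mem h.1, unip_iff.2 (unip_inv _ (unip_iff.1 h.2))⟩ }
  nil :=
    { carrier := {X | X ∈ G.lie ∧ ∀ a b, β b ≤ β a → X a b = 0}
      add_mem' := fun h1 h2 => ⟨add_mem h1.1 h2.1, fun a b hab => by
        rw [Matrix.add_apply, h1.2 a b hab, h2.2 a b hab, add_zero]⟩
      zero_mem' := ⟨zero_mem _, fun _ _ _ => rfl⟩
      smul_mem' := fun c X h => ⟨G.lie.smul_mem c h.1, fun a b hab => by
        rw [Matrix.smul_apply, h.2 a b hab, smul_zero]⟩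
      lie_mem' := fun h1 h2 => ⟨G.lie.lie_mem h1.1 h2.1, fun a b hab => by
        rw [LieRing.of_associative_ring_bracket, Matrix.sub_apply,
          strict_mul h1.2 (strict_triangular h2.2) a b hab,
          strict_mul h2.2 (strict_triangular h1.2) a b hab, sub_zero]⟩ }
  levi_le := fun _ h => h.1
  unip_le := fun _ h => h.1
  levi_lie_le := fun _ h => h.1
  nil_le := fun _ h => h.1
  normal := by
    rintro l ⟨hl, hl'⟩ u ⟨hu, hu'⟩
    refine ⟨mul_mem (mul_mem hl hu) (inv_mem hl), unip_iff.2 ?_⟩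
    have e : (l * u * l⁻¹).val - 1 = l.val * (u.val - 1) * l⁻¹.val := by
      rw [mul_sub, sub_mul, mul_one, ← Units.val_mul, ← Units.val_mul, ← Units.val_mul,
        mul_inv_cancel, Units.val_one]
    rw [e]
    exact strict_mul (mul_strict (diag_triangular hl') (unip_iff.1 hu'))
      (diag_triangular (diag_inv l hl'))
  ideal := by
    rintro Y ⟨hY, hY'⟩ Z ⟨hZ, hZ'⟩
    refine ⟨G.lie.lie_mem hY hZ, fun a b hab => ?_⟩
    rw [LieRing.of_associative_ring_bracket, Matrix.sub_apply,
      mul_strict (diag_triangular hY') hZ' a b hab, strict_mul hZ' (diag_triangular hY') a b hab,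
      sub_zero]
  ad_nil := fun l hl Z hZ => ⟨G.ad_mem l hl.1 Z hZ.1,
    strict_mul (mul_strict (diag_triangular hl.2) hZ.2) (diag_triangular (diag_inv l hl.2))⟩
  inf_grp := by
    rintro g ⟨_, h1⟩ ⟨_, h2⟩
    refine Units.ext (Matrix.ext fun a b => ?_)
    by_cases h : β a = β b
    · exact h2 a b h.ge
    · rw [h1 a b h, Units.val_one, Matrix.one_apply_ne (fun e => h (congrArg β e))]
  inf_lie := by
    rintro X ⟨_, h1⟩ ⟨_, h2⟩
    refine Matrix.ext fun a b => ?_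
    by_cases h : β a = β b
    · exact h2 a b h.ge
    · exact h1 a b h
  ad_unip := by
    rintro u ⟨hu, hu'⟩ Y ⟨hY, hY'⟩ Z ⟨hZ, hZ'⟩
    refine ⟨sub_mem (G.ad_mem u hu _ (add_mem hY hZ)) hY, fun a b hab => ?_⟩
    have h1 := unip_iff.1 hu'
    have h2 := unip_triangular h1
    have h3 := unip_inv u h1
    have h4 := unip_triangular h3
    have e : Ad k u (Y + Z) - Y =
        (u.val - 1) * (Y * u⁻¹.val) + Y * (u⁻¹.val - 1) + u.val * Z * u⁻¹.val := by
      rw [Ad_apply]; noncomm_ring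
    rw [e, Matrix.add_apply, Matrix.add_apply,
      strict_mul h1 ((diag_triangular hY').mul h4) a b hab,
      mul_strict (diag_triangular hY') h3 a b hab,
      strict_mul (mul_strict h2 hZ') h4 a b hab, add_zero, add_zero]

end General

section GeneralLinear

/-- The group `GL(n, K)` with its Lie algebra `𝔤𝔩(n, K)`. -/
def glPair (K : Type*) [Field K] (n : ℕ) : LiePair K K n where
  grp := ⊤
  lie := ⊤
  ad_mem := fun _ _ _ _ => LieSubalgebra.mem_top _

/-- The block number of a row or column for the partition `n = i + (n - i)`. -/
def glBlock (n i : ℕ) (a : Fin n) : ℕ := if a.val < i then 0 else 1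

/-- The parabolic `P_{i, j} = L_{i, j} U_{i, j}` of `GL(n, K)`, `j = n - i`. -/
def glParabolic (K : Type*) [Field K] (n i : ℕ) : Parabolic (glPair K n) :=
  blockParabolic (glPair K n) (glBlock n i)

end GeneralLinear

section Unitary

/-- The matrix `J_m` with ones on the second diagonal. -/
def J (K : Type*) [Field K] (m : ℕ) : Matrix (Fin m) (Fin m) K :=
  Matrix.of fun a b => if b = Fin.rev a then 1 else 0

/-- `A^* = (A^{[q]})ᵀ`, where `A^{[q]}` raises all entries to the power `q = |k|`. -/
def conjTr (k : Type*) {K : Type*} [Field k] [Fintype k] [Field K] [Algebra k K] {m : ℕ}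
    (A : Matrix (Fin m) (Fin m) K) : Matrix (Fin m) (Fin m) K :=
  (A.map fun x => x ^ Fintype.card k)ᵀ

variable (k K : Type*) [Field k] [Fintype k] [Field K] [Algebra k K] (m : ℕ)

theorem conjTr_eq (A : Matrix (Fin m) (Fin m) K) :
    conjTr k A = (A.map (FiniteField.frobeniusAlgHom k K))ᵀ := rfl

variable {m}

theorem conjTr_mul (A B : Matrix (Fin m) (Fin m) K) :
    conjTr k (A * B) = conjTr k B * conjTr k A := by
  rw [conjTr_eq, conjTr_eq, conjTr_eq, Matrix.map_mul, Matrix.transpose_mul]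

theorem conjTr_one : conjTr k (1 : Matrix (Fin m) (Fin m) K) = 1 := by
  rw [conjTr_eq, Matrix.map_one _ (map_zero _) (map_one _), Matrix.transpose_one]

theorem conjTr_add (A B : Matrix (Fin m) (Fin m) K) :
    conjTr k (A + B) = conjTr k A + conjTr k B := by
  rw [conjTr_eq, conjTr_eq, conjTr_eq, Matrix.map_add _ (map_add _), Matrix.transpose_add]

theorem conjTr_sub (A B : Matrix (Fin m) (Fin m) K) :
    conjTr k (A - B) = conjTr k A - conjTr k B := by
  rw [conjTr_eq, conjTr_eq, conjTr_eq, Matrix.map_sub _ (map_sub _), Matrix.transpose_sub]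

theorem conjTr_smul (c : k) (A : Matrix (Fin m) (Fin m) K) :
    conjTr k (c • A) = c • conjTr k A := by
  rw [conjTr_eq, conjTr_eq, Matrix.map_smul _ c (map_smul _ c), Matrix.transpose_smul]

theorem conjTr_zero : conjTr k (0 : Matrix (Fin m) (Fin m) K) = 0 := by
  rw [conjTr_eq, Matrix.map_zero _ (map_zero _), Matrix.transpose_zero]

theorem unitary_inv (g : GL (Fin m) K) (h : conjTr k g.val * J K m * g.val = J K m) :
    conjTr k g⁻¹.val * J K m * g⁻¹.val = J K m := by
  have h1 : conjTr k g⁻¹.val * conjTr k g.val = 1 := by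
    rw [← conjTr_mul, ← Units.val_mul, mul_inv_cancel, Units.val_one, conjTr_one]
  have h2 : g.val * g⁻¹.val = 1 := by rw [← Units.val_mul, mul_inv_cancel, Units.val_one]
  calc conjTr k g⁻¹.val * J K m * g⁻¹.val
      = (conjTr k g⁻¹.val * conjTr k g.val) * J K m * (g.val * g⁻¹.val) := by
        conv_lhs => rw [← h]
        simp only [mul_assoc]
    _ = J K m := by rw [h1, h2, one_mul, mul_one]

theorem unitary_comm (g : GL (Fin m) K) (h : conjTr k g.val * J K m * g.val = J K m) :
    conjTr k g.val * J K m = J K m * g⁻¹.val := by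
  have h2 : g.val * g⁻¹.val = 1 := by rw [← Units.val_mul, mul_inv_cancel, Units.val_one]
  conv_rhs => rw [← h]
  rw [mul_assoc _ g.val, h2, mul_one]

variable (m)

/-- For `K` a quadratic extension of the field `k` with `q` elements, the finite unitary group
`U(m, 𝔽_{q²})` of all `g` with `g^* J g = J`, with its Lie algebra `𝔲(m, 𝔽_{q²})` of all `X` with
`X^* J + J X = 0`. -/
def unitaryPair : LiePair k K m where
  grp :=
    { carrier := {g | conjTr k g.val * J K m * g.val = J K m}
      mul_mem' := by
        intro g h hg hh
        change conjTr k (g * h).val * J K m * (g * h).val = J K m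
        calc conjTr k (g * h).val * J K m * (g * h).val
            = conjTr k h.val * (conjTr k g.val * J K m * g.val) * h.val := by
              rw [Units.val_mul, conjTr_mul]
              simp only [mul_assoc]
          _ = J K m := by rw [hg, hh]
      one_mem' := by
        change conjTr k (1 : Matrix (Fin m) (Fin m) K) * J K m * 1 = J K m
        rw [conjTr_one, one_mul, mul_one]
      inv_mem' := fun {g} h => unitary_inv k K g h }
  lie :=
    { carrier := {X | conjTr k X * J K m + J K m * X = 0}
      add_mem' := by
        intro X Y hX hY
        change conjTr k (X + Y) * J K m + J K m * (X + Y) = 0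
        rw [conjTr_add, add_mul, mul_add, add_add_add_comm, hX, hY, add_zero]
      zero_mem' := by
        change conjTr k (0 : Matrix (Fin m) (Fin m) K) * J K m + J K m * 0 = 0
        rw [conjTr_zero, zero_mul, mul_zero, add_zero]
      smul_mem' := by
        intro c X hX
        change conjTr k (c • X) * J K m + J K m * (c • X) = 0
        rw [conjTr_smul, smul_mul_assoc, mul_smul_comm, ← smul_add, hX, smul_zero]
      lie_mem' := by
        intro X Y hX hY
        change conjTr k ⁅X, Y⁆ * J K m + J K m * ⁅X, Y⁆ = 0
        have hX' : conjTr k X * J K m = -(J K m * X) := eq_neg_of_add_eq_zero_left hX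
        have hY' : conjTr k Y * J K m = -(J K m * Y) := eq_neg_of_add_eq_zero_left hY
        rw [LieRing.of_associative_ring_bracket, conjTr_sub, conjTr_mul, conjTr_mul, sub_mul,
          mul_assoc, mul_assoc, hX', hY', mul_neg, mul_neg, ← mul_assoc, ← mul_assoc, hX', hY']
        noncomm_ring }
  ad_mem := by
    intro g hg X hX
    change conjTr k (Ad k g X) * J K m + J K m * Ad k g X = 0
    have h1 := unitary_comm k K g hg
    have h2 := unitary_comm k K g⁻¹ (unitary_inv k K g hg)
    rw [inv_inv] at h2
    calc conjTr k (Ad k g X) * J K m + J K m * Ad k g X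
        = conjTr k g⁻¹.val * conjTr k X * (conjTr k g.val * J K m)
            + (J K m * g.val) * X * g⁻¹.val := by
          rw [Ad_apply, conjTr_mul, conjTr_mul]
          simp only [mul_assoc]
      _ = conjTr k g⁻¹.val * (conjTr k X * J K m + J K m * X) * g⁻¹.val := by
          rw [h1, ← h2]
          simp only [mul_assoc, mul_add, add_mul]
      _ = 0 := by
          have h3 : conjTr k X * J K m + J K m * X = 0 := hX
          rw [h3, mul_zero, zero_mul]

/-- The block number of a row or column for the partition `2 n = i + 2 j + i`. -/
def unitaryBlock (i j m : ℕ) (a : Fin m) : ℕ :=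
  if a.val < i then 0 else if a.val < i + 2 * j then 1 else 2

/-- The parabolic of `U(2n, 𝔽_{q²})`, `n = i + j`, of the matrices in `U(2n, 𝔽_{q²})` that are block
upper triangular with respect to `2 n = i + 2 j + i`. Its Levi subgroup consists of the matrices
`diag(A, B, A')` with `A ∈ GL(i, 𝔽_{q²})`, `B ∈ U(2j, 𝔽_{q²})` and `A' = J_i (A^*)⁻¹ J_i`: this is
what `g^* J g = J` says for a block diagonal `g`. For a block unitriangular `g`
with blocks `C`, `D`, `C'` above the diagonal, it says `C' = - J_{2j} C^* J_i` and
`J_i D + D^* J_i = - J_i C J_{2j} C^* J_i`. -/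
def unitaryParabolic (n i j : ℕ) : Parabolic (unitaryPair k K (2 * n)) :=
  blockParabolic (unitaryPair k K (2 * n)) (unitaryBlock i j (2 * n))

end Unitary

end MackeyLie

end

/-! Induction is |P|⁻¹ times a sum over all of G, and G is the disjoint union of double cosets P'wP
with w running over representatives of W_{L'} \ W / W_L. On P'wP the sum of Φ'(g⁻¹Xg) equals |P| /
|P' ∩ wPw⁻¹| times the sum of Φ'((pw)⁻¹X(pw)) over p ∈ P'. Put X = Y + Z, average over Z ∈ 𝔲', and
write p = lu. Bijections of 𝔲' induced by l and u leave, for every u, the sum over Z of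
Φ'(w⁻¹(Ad(l⁻¹)Y + Z)w). A nonzero term has its argument in 𝔭, which forces Ad(l⁻¹)Y ∈ 𝔭'_w and Z ∈
𝔲' ∩ w𝔭w⁻¹ separately. The latter space is w𝔲_w w⁻¹ ⊕ (𝔲' ∩ w𝔲w⁻¹): Φ' ignores the second summand,
averaging over the first is restriction to 𝔩_w, and the sum over l ∈ L' is induction from L'_w U'_w.
The constants match because |U'| = |𝔲'| and |P' ∩ wPw⁻¹| = |P'_w| · |𝔲' ∩ w𝔭w⁻¹|. This is
`Parabolic.mackey`.

For a permutation matrix w, conjugation only relabels the matrix positions, so the block conditions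
on w⁻¹Xw are vanishing conditions on entries of X. All decompositions come from taking block
diagonal parts (`diagPart`). The cardinalities reduce to |U' ∩ wPw⁻¹| = |𝔲' ∩ w𝔭w⁻¹|, which is g ↦ g
− 1 for GL and the Cayley transform for U, where 2 is invertible.

It remains to identify P' \ G / P with W_{L'} \ W / W_L. Surjectivity is the Bruhat decomposition.
For injectivity, ranks of corner submatrices show that P'wP determines the number of ones of w in
each block (`card_cell_eq`), and two elements of W with the same numbers differ by W_{L'} and W_L.
The unitary case is GL with a symmetry. The unitary group is the fixed group of g ↦ J(g^*)⁻¹J, so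
uniqueness in the refined Bruhat decomposition (`IsBruhat.unique`) makes all factors of a unitary g
unitary. The matching permutation must commute with the reversal of indices, which can be arranged
because 2n is even and the reversal has no fixed point. -/

noncomputable section

namespace MackeyLie

attribute [local instance] LieRing.ofAssociativeRing

/-! ### Sums over cosets and double cosets of a finite group -/

section GroupSums

variable {Γ : Type*} [Group Γ]

open Classical in
/-- Summation over a finite group of a function on the cosets of a subgroup. -/
theorem sum_comp_mk [Fintype Γ] (H : Subgroup Γ) (f : Γ ⧸ H → ℝ) :
    ∑ g : Γ, f g = Nat.card H * ∑ c, f c := by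
  rw [← Finset.sum_fiberwise_of_maps_to (s := Finset.univ) (t := Finset.univ)
    (g := fun g : Γ => (g : Γ ⧸ H)) (fun _ _ => Finset.mem_univ _), Finset.mul_sum]
  refine Finset.sum_congr rfl fun c _ => ?_
  rw [Finset.sum_congr rfl (g := fun _ => f c)
    (fun g hg => by rw [(Finset.mem_filter.1 hg).2]), Finset.sum_const, nsmul_eq_mul]
  congr 2
  have h := QuotientGroup.card_preimage_mk H {c}
  rw [Nat.card_unique (α := ({c} : Set (Γ ⧸ H))), mul_one] at h
  rw [← h, Nat.subtype_card]
  intro x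
  simp

/-- The fibre of `(a, b) ↦ a w b` over a point of the double coset `A w B`. -/
def doubleCosetFiberEquiv (A B : Subgroup Γ) (w : Γ) (a₀ : A) (b₀ : B) :
    {x : A × B // x.1.1 * w * x.2.1 = a₀.1 * w * b₀.1} ≃
      (A ⊓ B.comap (MulAut.conj w⁻¹).toMonoidHom : Subgroup Γ) where
  toFun x := ⟨a₀.1⁻¹ * x.1.1.1, A.mul_mem (A.inv_mem a₀.2) x.1.1.2, by
    -- From awb = a₀wb₀ one gets w⁻¹(a₀⁻¹a)w = b₀b⁻¹, which lies in B.
    have h : MulAut.conj w⁻¹ (a₀.1⁻¹ * x.1.1.1) = b₀.1 * x.1.2.1⁻¹ := by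
      rw [MulAut.conj_apply, eq_mul_inv_iff_mul_eq, inv_inv]
      calc _ = w⁻¹ * a₀.1⁻¹ * (x.1.1.1 * w * x.1.2.1) := by group
        _ = _ := by rw [x.2]; group
    change MulAut.conj w⁻¹ (a₀.1⁻¹ * x.1.1.1) ∈ B
    rw [h]
    exact B.mul_mem b₀.2 (B.inv_mem x.1.2.2)⟩
  invFun y := ⟨(⟨a₀.1 * y.1, A.mul_mem a₀.2 y.2.1⟩,
      ⟨(MulAut.conj w⁻¹ y.1)⁻¹ * b₀.1, B.mul_mem (B.inv_mem y.2.2) b₀.2⟩), by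
    simp only [MulAut.conj_apply]
    group⟩
  left_inv x := by
    refine Subtype.ext (Prod.ext (Subtype.ext ?_) (Subtype.ext ?_))
    · simp
    · simp only [MulAut.conj_apply]
      rw [inv_mul_eq_iff_eq_mul]
      have h := x.2
      calc b₀.1 = w⁻¹ * a₀.1⁻¹ * (a₀.1 * w * b₀.1) := by group
        _ = w⁻¹ * a₀.1⁻¹ * (x.1.1.1 * w * x.1.2.1) := congrArg _ h.symm
        _ = _ := by group
  right_inv y := Subtype.ext (by simp)

theorem mem_doubleCoset_iff (A B : Subgroup Γ) (w g : Γ) :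
    g ∈ DoubleCoset.doubleCoset w (A : Set Γ) (B : Set Γ) ↔ ∃ a : A, ∃ b : B, a.1 * w * b.1 = g := by
  rw [DoubleCoset.mem_doubleCoset]
  constructor
  · rintro ⟨a, ha, b, hb, rfl⟩
    exact ⟨⟨a, ha⟩, ⟨b, hb⟩, rfl⟩
  · rintro ⟨a, b, rfl⟩
    exact ⟨a, a.2, b, b.2, rfl⟩

open Classical in
/-- Summation over a double coset `A w B` of a function that is invariant under `B`. -/
theorem sum_doubleCoset [Fintype Γ] (A B : Subgroup Γ) (w : Γ) (F : Γ → ℝ)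
    (hF : ∀ g, ∀ b ∈ B, F (g * b) = F g) :
    (Nat.card (A ⊓ B.comap (MulAut.conj w⁻¹).toMonoidHom : Subgroup Γ) : ℝ) *
      ∑ g : Γ, (if g ∈ DoubleCoset.doubleCoset w (A : Set Γ) (B : Set Γ) then F g else 0) =
    Nat.card B * ∑ a : A, F (a.1 * w) := by
  have h1 : ∑ x : A × B, F (x.1.1 * w * x.2.1) = Nat.card B * ∑ a : A, F (a.1 * w) := by
    rw [Fintype.sum_prod_type, Finset.mul_sum]
    refine Finset.sum_congr rfl fun a _ => ?_
    rw [Finset.sum_congr rfl (g := fun _ => F (a.1 * w)) (fun b _ => hF _ _ b.2),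
      Finset.sum_const, nsmul_eq_mul, Nat.card_eq_fintype_card, Finset.card_univ]
  -- Group the pairs by the value of awb: a fibre is empty off the double coset and has |A ∩ wBw⁻¹|
  -- elements on it.
  rw [← h1, ← Finset.sum_fiberwise_of_maps_to (s := Finset.univ) (t := Finset.univ)
    (g := fun x : A × B => x.1.1 * w * x.2.1) (fun _ _ => Finset.mem_univ _), Finset.mul_sum]
  refine Finset.sum_congr rfl fun g _ => ?_
  rw [Finset.sum_congr rfl (g := fun _ => F g)
    (fun x hx => by rw [(Finset.mem_filter.1 hx).2]), Finset.sum_const, nsmul_eq_mul]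
  split_ifs with h
  · obtain ⟨a₀, b₀, rfl⟩ := (mem_doubleCoset_iff A B w g).1 h
    congr 2
    rw [← Nat.card_congr (doubleCosetFiberEquiv A B w a₀ b₀), Nat.subtype_card]
    intro x
    simp
  · rw [Finset.filter_false_of_mem, Finset.card_empty, Nat.cast_zero, zero_mul, mul_zero]
    intro x _ hx
    exact h ((mem_doubleCoset_iff A B w g).2 ⟨x.1, x.2, hx⟩)

end GroupSums

/-! ### Mackey's formula for abstract parabolics -/

namespace Parabolic

variable {k K : Type*} [Field k] [Field K] [Algebra k K] {m : ℕ} {G : LiePair k K m}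
  (D : Parabolic G)

theorem P_le : D.P ≤ G.grp := sup_le D.levi_le D.unip_le

theorem levi_le_P : D.levi.grp ≤ D.P := le_sup_left

theorem unip_le_P : D.unip ≤ D.P := le_sup_right

theorem mem_P_iff (g : GL (Fin m) K) : g ∈ D.P ↔ ∃ l ∈ D.levi.grp, ∃ u ∈ D.unip, l * u = g := by
  constructor
  · intro hg
    have h : D.P ≤
        { carrier := {g | ∃ l ∈ D.levi.grp, ∃ u ∈ D.unip, l * u = g}
          mul_mem' := by
            rintro _ _ ⟨l, hl, u, hu, rfl⟩ ⟨l', hl', u', hu', rfl⟩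
            refine ⟨l * l', mul_mem hl hl', l'⁻¹ * u * l' * u',
              mul_mem ?_ hu', by group⟩
            simpa using D.normal _ (inv_mem hl') u hu
          one_mem' := ⟨1, one_mem _, 1, one_mem _, one_mul _⟩
          inv_mem' := by
            rintro _ ⟨l, hl, u, hu, rfl⟩
            exact ⟨l⁻¹, inv_mem hl, l * u⁻¹ * l⁻¹, D.normal l hl _ (inv_mem hu), by group⟩ } :=
      sup_le (fun l hl => ⟨l, hl, 1, one_mem _, mul_one _⟩)
        (fun u hu => ⟨1, one_mem _, u, hu, one_mul _⟩)
    exact h hg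
  · rintro ⟨l, hl, u, hu, rfl⟩
    exact D.P.mul_mem (D.levi_le_P hl) (D.unip_le_P hu)

/-- The bijection `L × U → P`, `(l, u) ↦ l u`. -/
def mulEquiv : D.levi.grp × D.unip ≃ D.P :=
  Equiv.ofBijective (fun x => ⟨x.1.1 * x.2.1, D.P.mul_mem (D.levi_le_P x.1.2) (D.unip_le_P x.2.2)⟩)
    ⟨by
      rintro ⟨⟨l, hl⟩, u, hu⟩ ⟨⟨l', hl'⟩, u', hu'⟩ h
      have h : l * u = l' * u' := congrArg Subtype.val h
      have e : l'⁻¹ * l = u' * u⁻¹ := by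
        rw [inv_mul_eq_iff_eq_mul, ← mul_assoc, ← h, mul_inv_cancel_right]
      have e1 := D.inf_grp _ (mul_mem (inv_mem hl') hl) (e ▸ mul_mem hu' (inv_mem hu))
      obtain rfl : l' = l := inv_mul_eq_one.1 e1
      obtain rfl : u = u' := mul_left_cancel h
      rfl,
    by
      rintro ⟨g, hg⟩
      obtain ⟨l, hl, u, hu, rfl⟩ := (D.mem_P_iff g).1 hg
      exact ⟨(⟨l, hl⟩, ⟨u, hu⟩), rfl⟩⟩

/-- For `u ∈ U` and `Y ∈ 𝔩`, the bijection `Z ↦ Ad(u) (Y + Z) - Y` of `𝔲`. -/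
def unipEquiv (u : D.unip) (Y : D.levi.lie) : D.nil ≃ D.nil where
  toFun Z := ⟨Ad k u.1 (Y.1 + Z.1) - Y.1, D.ad_unip u.1 u.2 Y.1 Y.2 Z.1 Z.2⟩
  invFun Z := ⟨Ad k u.1⁻¹ (Y.1 + Z.1) - Y.1, D.ad_unip u.1⁻¹ (inv_mem u.2) Y.1 Y.2 Z.1 Z.2⟩
  left_inv Z := Subtype.ext (by
    dsimp only
    rw [add_sub_cancel, Ad_inv_Ad, add_sub_cancel_left])
  right_inv Z := Subtype.ext (by
    dsimp only
    rw [add_sub_cancel, Ad_Ad_inv, add_sub_cancel_left])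

open Classical in
-- Each coset of P is counted |P| times. Unlike the sum over G/P, the sum over group elements can be
-- regrouped along double cosets P'wP.
theorem card_mul_ind [Finite K] [Fintype (GL (Fin m) K)] (Φ : D.levi.Inv) (X : G.lie) :
    (Nat.card D.P : ℝ) * (D.ind Φ).1 X =
      ∑ g : GL (Fin m) K, if g ∈ G.grp then D.extend Φ.1 (Ad k g⁻¹ X.1) else 0 := by
  have h := sum_comp_mk (D.P.subgroupOf G.grp) (D.indTerm Φ X.1)
  rw [Nat.card_congr (Subgroup.subgroupOfEquivOfLe D.P_le).toEquiv] at h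
  rw [← Finset.sum_filter, Finset.sum_subtype (p := fun g => g ∈ G.grp)]
  · change _ * (∑ᶠ c, D.indTerm Φ X.1 c) = _
    rw [finsum_eq_sum_of_fintype, ← h]
    rfl
  · simp

variable (D' : Parabolic G) (w : GL (Fin m) K)

/-- The elements of the nilpotent part `𝔲'` that lie in `Ad(w) 𝔭`. -/
def nilInf : Submodule k (Matrix (Fin m) (Fin m) K) :=
  D'.nil.toSubmodule ⊓ D.parLie.comap (Ad k w⁻¹ : _ →ₗ[k] _)

/-- The splitting `𝔲' ∩ w 𝔭 w⁻¹ = (𝔲' ∩ w 𝔩 w⁻¹) ⊕ (𝔲' ∩ w 𝔲 w⁻¹)`. -/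
theorem nilInf_split (hD : ∀ Z ∈ D'.nil, Ad k w⁻¹ Z ∈ D.parLie →
      ∃ A ∈ (D.rel D' w).nil, Ad k w⁻¹ Z - A ∈ D.nil) :
    ∃ e : (D.rel D' w).nil × (D'.nil ⊓ D.nil.comap (Ad k w⁻¹) : LieSubalgebra k _) ≃
        nilInf D D' w, ∀ x, (e x).1 = Ad k w x.1.1 + x.2.1 := by
  refine ⟨Equiv.ofBijective (fun x => ⟨Ad k w x.1.1 + x.2.1, ?_, ?_⟩) ⟨?_, ?_⟩, fun _ => rfl⟩
  · exact D'.nil.add_mem x.1.2.2 x.2.2.1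
  · change Ad k w⁻¹ (Ad k w x.1.1 + x.2.1) ∈ D.parLie
    rw [map_add, Ad_inv_Ad]
    refine D.mem_parLie x.1.2.1 ?_
    rw [add_sub_cancel_left]
    exact x.2.2.2
  · rintro ⟨⟨a, ha⟩, b, hb⟩ ⟨⟨a', ha'⟩, b', hb'⟩ h
    have h : Ad k w a + b = Ad k w a' + b' := congrArg Subtype.val h
    have h1 := congrArg (Ad k w⁻¹) h
    rw [map_add, map_add, Ad_inv_Ad, Ad_inv_Ad] at h1
    have e : a - a' = Ad k w⁻¹ b' - Ad k w⁻¹ b := by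
      rw [sub_eq_sub_iff_add_eq_add, h1, add_comm]
    have e1 := D.inf_lie _ (D.levi.lie.sub_mem ha.1 ha'.1) (e ▸ D.nil.sub_mem hb'.2 hb.2)
    obtain rfl := sub_eq_zero.1 e1
    obtain rfl := add_left_cancel h
    rfl
  · rintro ⟨Z, h1, h2⟩
    obtain ⟨A, hA, hA'⟩ := hD Z h1 h2
    refine ⟨(⟨A, hA⟩, ⟨Z - Ad k w A, D'.nil.sub_mem h1 hA.2, ?_⟩),
      Subtype.ext (add_sub_cancel _ _)⟩
    change Ad k w⁻¹ (Z - Ad k w A) ∈ D.nil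
    rw [map_sub, Ad_inv_Ad]
    exact hA'

open Classical in
/-- The contribution of `w` to Mackey's formula, before induction from `L'_w U'_w` to `L'`. -/
theorem sum_extend [Finite K] [Fintype D'.nil]
    (hC : ∀ Y ∈ D'.levi.lie, ∀ Z ∈ D'.nil, Ad k w⁻¹ (Y + Z) ∈ D.parLie →
      Y ∈ (D'.rel D w⁻¹).parLie ∧ Ad k w⁻¹ Z ∈ D.parLie)
    (hD : ∀ Z ∈ D'.nil, Ad k w⁻¹ Z ∈ D.parLie →
      ∃ A ∈ (D.rel D' w).nil, Ad k w⁻¹ Z - A ∈ D.nil)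
    (Φ : D.levi.Inv) (Y : Matrix (Fin m) (Fin m) K) (hY : Y ∈ D'.levi.lie) :
    ∑ Z : D'.nil, D.extend Φ.1 (Ad k w⁻¹ (Y + Z.1)) =
      Nat.card (nilInf D D' w) *
        (D'.rel D w⁻¹).extend (D.T D' w ((D.rel D' w).res Φ)).1 Y := by
  by_cases hY' : Y ∈ (D'.rel D w⁻¹).parLie
  · obtain ⟨Y₀, hY₀⟩ := (D'.rel D w⁻¹).exists_proj ⟨Y, hY'⟩
    obtain ⟨e, he⟩ := nilInf_split D D' w hD
    rw [extend_eq _ _ _ _ hY₀]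
    have : Fintype (D.rel D' w).nil := Fintype.ofFinite _
    have : Fintype (D'.nil ⊓ D.nil.comap (Ad k w⁻¹) : LieSubalgebra k _) := Fintype.ofFinite _
    have : Fintype (nilInf D D' w) := Fintype.ofFinite _
    -- By `hC`, the function extended by zero vanishes unless Z lies in Ad(w)𝔭.
    have h1 : ∑ Z : D'.nil, D.extend Φ.1 (Ad k w⁻¹ (Y + Z.1)) =
        ∑ Z : nilInf D D' w, D.extend Φ.1 (Ad k w⁻¹ (Y + Z.1)) := by
      symm
      refine Finset.sum_of_injOn (fun Z => (⟨Z.1, Z.2.1⟩ : D'.nil)) ?_ ?_ ?_ ?_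
      · intro a _ b _ hab
        exact Subtype.ext (congrArg (fun z : D'.nil => z.1) hab)
      · intro _ _
        exact Finset.mem_coe.2 (Finset.mem_univ _)
      · intro Z _ hZ
        refine D.extend_eq_zero _ _ fun h => hZ ?_
        exact ⟨⟨Z.1, Z.2, (hC Y hY Z.1 Z.2 h).2⟩, Finset.mem_coe.2 (Finset.mem_univ _), rfl⟩
      · intro _ _
        rfl
    have h2 : (D.T D' w ((D.rel D' w).res Φ)).1 Y₀ = (Nat.card (D.rel D' w).nil : ℝ)⁻¹ *
        ∑ Z : (D.rel D' w).nil, D.extend Φ.1 (Ad k w⁻¹ Y₀.1 + Z.1) := by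
      refine congrArg ((Nat.card (D.rel D' w).nil : ℝ)⁻¹ * ·) ?_
      rw [finsum_eq_sum_of_fintype]
      refine Finset.sum_congr rfl fun Z _ => (D.extend_eq Φ.1 _
        (⟨Ad k w⁻¹ Y₀.1, Y₀.2.2⟩ + ⟨Z.1, Z.2.1⟩) ?_).symm
      change (Ad k w⁻¹ Y₀.1 + Z.1) - (Ad k w⁻¹ Y₀.1 + Z.1) ∈ D.nil
      rw [sub_self]
      exact D.nil.zero_mem
    rw [h1, h2, ← e.sum_comp, Fintype.sum_prod_type, ← Nat.card_congr e, Nat.card_prod,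
      Nat.cast_mul]
    -- Both Y − Y₀ and y are carried into 𝔲 by Ad(w⁻¹), so neither affects the projection to 𝔩. The
    -- free variable y only contributes a factor to the count.
    have h3 : ∀ x y, D.extend Φ.1 (Ad k w⁻¹ (Y + (e (x, y)).1)) =
        D.extend Φ.1 (Ad k w⁻¹ Y₀.1 + x.1) := by
      intro x y
      rw [D.extend_eq Φ.1 (Ad k w⁻¹ Y₀.1 + x.1) (⟨Ad k w⁻¹ Y₀.1, Y₀.2.2⟩ + ⟨x.1, x.2.1⟩)]
      · refine D.extend_eq Φ.1 _ _ ?_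
        have h4 := D.nil.add_mem hY₀.2 y.2.2
        change Ad k w⁻¹ (Y + (e (x, y)).1) - (Ad k w⁻¹ Y₀.1 + x.1) ∈ D.nil
        have e4 : Ad k w⁻¹ (Y + (e (x, y)).1) - (Ad k w⁻¹ Y₀.1 + x.1) =
            Ad k w⁻¹ (Y - Y₀.1) + Ad k w⁻¹ y.1 := by
          rw [he, map_add, map_add, Ad_inv_Ad, map_sub]
          abel
        rw [e4]
        exact h4
      · change (Ad k w⁻¹ Y₀.1 + x.1) - (Ad k w⁻¹ Y₀.1 + x.1) ∈ D.nil
        rw [sub_self]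
        exact D.nil.zero_mem
    simp only [h3, Finset.sum_const, nsmul_eq_mul, Finset.card_univ, ← Nat.card_eq_fintype_card]
    rw [← Finset.mul_sum]
    have h5 : (Nat.card (D.rel D' w).nil : ℝ) ≠ 0 := by
      exact_mod_cast Nat.card_pos.ne'
    field_simp
  · rw [extend_eq_zero _ _ _ hY', mul_zero]
    exact Finset.sum_eq_zero fun Z _ => D.extend_eq_zero _ _ fun h => hY' (hC Y hY Z.1 Z.2 h).1

/-- Mackey's formula for two parabolics `P`, `P'` of `G` and representatives of the double cosets
`P' \ G / P` that are in good position with respect to both parabolics. -/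
theorem mackey [Finite K] (R : Finset (GL (Fin m) K))
    (hR : ∀ g ∈ G.grp, ∃! r, r ∈ R ∧
      g ∈ DoubleCoset.doubleCoset r (D'.P : Set (GL (Fin m) K)) (D.P : Set (GL (Fin m) K)))
    (hG : ∀ r ∈ R, r ∈ G.grp)
    (hU : Nat.card D'.unip = Nat.card D'.nil)
    (hP : ∀ w ∈ R, Nat.card (D'.P ⊓ D.P.comap (MulAut.conj w⁻¹).toMonoidHom :
      Subgroup (GL (Fin m) K)) = Nat.card (D'.rel D w⁻¹).P * Nat.card (nilInf D D' w))
    (hC : ∀ w ∈ R, ∀ Y ∈ D'.levi.lie, ∀ Z ∈ D'.nil, Ad k w⁻¹ (Y + Z) ∈ D.parLie →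
      Y ∈ (D'.rel D w⁻¹).parLie ∧ Ad k w⁻¹ Z ∈ D.parLie)
    (hD : ∀ w ∈ R, ∀ Z ∈ D'.nil, Ad k w⁻¹ Z ∈ D.parLie →
      ∃ A ∈ (D.rel D' w).nil, Ad k w⁻¹ Z - A ∈ D.nil) :
    D'.res ∘ₗ D.ind = ∑ w ∈ R,
      (D'.rel D w⁻¹).ind ∘ₗ (D.T D' w).toLinearMap ∘ₗ (D.rel D' w).res := by
  classical
  refine LinearMap.ext fun Φ => Subtype.ext (funext fun Y => ?_)
  have : Fintype (GL (Fin m) K) := Fintype.ofFinite _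
  have : Fintype D'.nil := Fintype.ofFinite _
  have card_ne : ∀ H : Subgroup (GL (Fin m) K), (Nat.card H : ℝ) ≠ 0 := fun H => by
    exact_mod_cast Nat.card_pos.ne'
  have hF : ∀ X : Matrix (Fin m) (Fin m) K, ∀ g, ∀ b ∈ D.P,
      D.extend Φ.1 (Ad k (g * b)⁻¹ X) = D.extend Φ.1 (Ad k g⁻¹ X) := by
    intro X g b hb
    rw [mul_inv_rev, Ad_mul, D.extend_P Φ _ (inv_mem hb)]
  -- Induction regrouped along the double cosets P'wP; the factor |P| from `sum_doubleCoset` cancels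
  -- the one in `card_mul_ind`.
  have hind : ∀ X : G.lie, (D.ind Φ).1 X = ∑ w ∈ R,
      (Nat.card (D'.P ⊓ D.P.comap (MulAut.conj w⁻¹).toMonoidHom :
        Subgroup (GL (Fin m) K)) : ℝ)⁻¹ *
      ∑ p : D'.P, D.extend Φ.1 (Ad k (p.1 * w)⁻¹ X.1) := by
    intro X
    refine mul_left_cancel₀ (card_ne D.P) ?_
    rw [card_mul_ind, Finset.mul_sum]
    have h1 : ∀ g : GL (Fin m) K, (if g ∈ G.grp then D.extend Φ.1 (Ad k g⁻¹ X.1) else 0) =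
        ∑ w ∈ R, if g ∈ DoubleCoset.doubleCoset w (D'.P : Set (GL (Fin m) K))
          (D.P : Set (GL (Fin m) K)) then D.extend Φ.1 (Ad k g⁻¹ X.1) else 0 := by
      intro g
      split_ifs with hg
      · obtain ⟨r, ⟨hr, hr'⟩, hr''⟩ := hR g hg
        rw [Finset.sum_eq_single_of_mem r hr, if_pos hr']
        intro b hb hbr
        rw [if_neg fun h => hbr (hr'' b ⟨hb, h⟩)]
      · refine (Finset.sum_eq_zero fun w hw => if_neg fun h => hg ?_).symm
        obtain ⟨a, b, rfl⟩ := (mem_doubleCoset_iff _ _ _ _).1 h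
        exact mul_mem (mul_mem (D'.P_le a.2) (hG w hw)) (D.P_le b.2)
    rw [Finset.sum_congr rfl fun g _ => h1 g, Finset.sum_comm]
    refine Finset.sum_congr rfl fun w _ => ?_
    have h2 := sum_doubleCoset D'.P D.P w (fun g => D.extend Φ.1 (Ad k g⁻¹ X.1)) (hF X.1)
    have h3 := card_ne (D'.P ⊓ D.P.comap (MulAut.conj w⁻¹).toMonoidHom)
    rw [mul_left_comm, ← h2, inv_mul_cancel_left₀ h3]
  change (Nat.card D'.nil : ℝ)⁻¹ * ∑ᶠ Z : D'.nil,
    (D.ind Φ).1 (⟨Y.1, D'.levi_lie_le Y.2⟩ + ⟨Z.1, D'.nil_le Z.2⟩) = _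
  rw [finsum_eq_sum_of_fintype, Finset.sum_congr rfl fun Z _ => hind _, Finset.sum_comm,
    LinearMap.sum_apply, AddSubmonoidClass.coe_finsetSum, Finset.sum_apply, Finset.mul_sum]
  refine Finset.sum_congr rfl fun w hw => ?_
  have : Fintype D'.levi.grp := Fintype.ofFinite _
  have : Fintype D'.unip := Fintype.ofFinite _
  rw [← Finset.mul_sum]
  -- With p = lu, the inner sum over Z does not depend on u, which gives the factor |U'|; for fixed
  -- l it is the sum of `sum_extend` at Ad(l⁻¹)Y.
  have h4 : ∑ Z : D'.nil, ∑ p : D'.P, D.extend Φ.1 (Ad k (p.1 * w)⁻¹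
        ((⟨Y.1, D'.levi_lie_le Y.2⟩ + ⟨Z.1, D'.nil_le Z.2⟩ : G.lie) : Matrix (Fin m) (Fin m) K)) =
      Nat.card D'.unip * (Nat.card (nilInf D D' w) * ∑ l : D'.levi.grp,
        (D'.rel D w⁻¹).extend (D.T D' w ((D.rel D' w).res Φ)).1 (Ad k l.1⁻¹ Y.1)) := by
    rw [Finset.sum_comm, ← (mulEquiv D').sum_comp, Fintype.sum_prod_type, Finset.mul_sum,
      Finset.mul_sum]
    refine Finset.sum_congr rfl fun l _ => ?_
    refine Eq.trans ?_ (congrArg _ (sum_extend D D' w (hC w hw) (hD w hw) Φ _ (D'.levi.adj l⁻¹ Y).2))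
    have h5 : ∀ u : D'.unip, ∑ Z : D'.nil, D.extend Φ.1 (Ad k ((mulEquiv D' (l, u)).1 * w)⁻¹
        ((⟨Y.1, D'.levi_lie_le Y.2⟩ + ⟨Z.1, D'.nil_le Z.2⟩ : G.lie) :
          Matrix (Fin m) (Fin m) K)) =
        ∑ Z : D'.nil, D.extend Φ.1 (Ad k w⁻¹ ((D'.levi.adj l⁻¹ Y).1 + Z.1)) := by
      intro u
      -- Reindex 𝔲' by Z ↦ Ad(u⁻¹)(Ad(l⁻¹)(Y + Z)) − Ad(l⁻¹)Y, so that u disappears and l acts on Y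
      -- alone.
      refine Eq.trans ?_ (((D'.nilEquiv l⁻¹).trans
        (D'.unipEquiv u⁻¹ (D'.levi.adj l⁻¹ Y))).sum_comp
          (fun Z => D.extend Φ.1 (Ad k w⁻¹ ((D'.levi.adj l⁻¹ Y).1 + Z.1))))
      refine Finset.sum_congr rfl fun Z _ => ?_
      congr 1
      change Ad k (l.1 * u.1 * w)⁻¹ (Y.1 + Z.1) = Ad k w⁻¹ (Ad k l.1⁻¹ Y.1 +
        (Ad k u.1⁻¹ (Ad k l.1⁻¹ Y.1 + Ad k l.1⁻¹ Z.1) - Ad k l.1⁻¹ Y.1))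
      rw [add_sub_cancel, mul_inv_rev, mul_inv_rev, Ad_mul, Ad_mul, map_add (Ad k l.1⁻¹)]
    rw [Finset.sum_congr rfl fun u _ => h5 u, Finset.sum_const, nsmul_eq_mul, Finset.card_univ,
      Nat.card_eq_fintype_card]
    rfl
  have h6 : (Nat.card (D'.rel D w⁻¹).P : ℝ) *
      ((D'.rel D w⁻¹).ind (D.T D' w ((D.rel D' w).res Φ))).1 Y =
      ∑ l : D'.levi.grp,
        (D'.rel D w⁻¹).extend (D.T D' w ((D.rel D' w).res Φ)).1 (Ad k l.1⁻¹ Y.1) := by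
    rw [card_mul_ind, ← Finset.sum_filter, Finset.sum_subtype (p := fun g => g ∈ D'.levi.grp)]
    simp
  rw [h4, ← h6, hP w hw, hU]
  have h7 : (Nat.card D'.nil : ℝ) ≠ 0 := by exact_mod_cast Nat.card_pos.ne'
  have h8 : (Nat.card (nilInf D D' w) : ℝ) ≠ 0 := by exact_mod_cast Nat.card_pos.ne'
  have h9 := card_ne (D'.rel D w⁻¹).P
  push_cast
  field_simp
  rfl

end Parabolic

end MackeyLie

end
noncomputable section

namespace MackeyLie

attribute [local instance] LieRing.ofAssociativeRing

variable {k K : Type*} [Field k] [Field K] [Algebra k K] {m : ℕ}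

/-! ### Permutation matrices -/

section Perm

/-- A permutation matrix as an invertible matrix. -/
def permGL (K : Type*) [Field K] {m : ℕ} (σ : Equiv.Perm (Fin m)) : GL (Fin m) K where
  val := σ.permMatrix K
  inv := (σ⁻¹).permMatrix K
  val_inv := by rw [← Matrix.permMatrix_mul]; simp
  inv_val := by rw [← Matrix.permMatrix_mul]; simp

theorem permGL_mul (σ τ : Equiv.Perm (Fin m)) : permGL K σ * permGL K τ = permGL K (τ * σ) :=
  Units.ext (Matrix.permMatrix_mul _ _).symm

theorem permGL_inv (σ : Equiv.Perm (Fin m)) : (permGL K σ)⁻¹ = permGL K σ⁻¹ :=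
  inv_eq_of_mul_eq_one_right (by rw [permGL_mul, inv_mul_cancel]; exact Units.ext (by simp [permGL]))

theorem permGL_apply (σ : Equiv.Perm (Fin m)) (a b : Fin m) :
    (permGL K σ).val a b = if σ a = b then 1 else 0 := by
  simp [permGL, Equiv.Perm.permMatrix, PEquiv.toMatrix_apply, Equiv.toPEquiv_apply, eq_comm]

theorem permGL_mul_apply (σ : Equiv.Perm (Fin m)) (X : Matrix (Fin m) (Fin m) K) (a b : Fin m) :
    ((permGL K σ).val * X) a b = X (σ a) b := by
  simp [Matrix.mul_apply, permGL_apply]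

theorem mul_permGL_apply (σ : Equiv.Perm (Fin m)) (X : Matrix (Fin m) (Fin m) K) (a b : Fin m) :
    (X * (permGL K σ).val) a (σ b) = X a b := by
  simp [Matrix.mul_apply, permGL_apply]

/-- Conjugation moves position (a, b) to (σ a, σ b). Hence a block condition for `β` on w⁻¹Xw is the
same condition for `β ∘ σ` on X, where `β ∘ σ` need not be monotone. -/
theorem permGL_conj_apply (σ : Equiv.Perm (Fin m)) (X : Matrix (Fin m) (Fin m) K) (a b : Fin m) :
    ((permGL K σ)⁻¹.val * X * (permGL K σ).val) (σ a) (σ b) = X a b := by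
  rw [mul_permGL_apply, permGL_inv, permGL_mul_apply]
  simp

theorem mem_weyl_iff {G : LiePair k K m} (g : GL (Fin m) K) :
    g ∈ weyl G ↔ ∃ σ, permGL K σ = g ∧ permGL K σ ∈ G.grp := by
  constructor
  · rintro ⟨hg, σ, hσ⟩
    obtain rfl : permGL K σ = g := Units.ext hσ.symm
    exact ⟨σ, rfl, hg⟩
  · rintro ⟨σ, rfl, h⟩
    exact ⟨h, σ, rfl⟩

end Perm

/-! ### Block diagonal parts -/

section DiagPart

variable {β γ : Fin m → ℕ} {X Y : Matrix (Fin m) (Fin m) K}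

/-- The block diagonal part of a matrix, for the block numbers `β`. -/
def diagPart (β : Fin m → ℕ) (X : Matrix (Fin m) (Fin m) K) : Matrix (Fin m) (Fin m) K :=
  Matrix.of fun a b => if β a = β b then X a b else 0

theorem diagPart_apply (a b : Fin m) :
    diagPart β X a b = if β a = β b then X a b else 0 := rfl

theorem diagPart_diag (a b : Fin m) (h : β a ≠ β b) : diagPart β X a b = 0 := if_neg h

/-- In a product of block triangular matrices, a nonzero path a → c → b cannot decrease the block
number; if it starts and ends in the same block, it never leaves it. -/
theorem diagPart_mul (hX : X.BlockTriangular β) (hY : Y.BlockTriangular β) :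
    diagPart β (X * Y) = diagPart β X * diagPart β Y := by
  refine Matrix.ext fun a b => ?_
  rw [diagPart_apply]
  split_ifs with h
  · rw [Matrix.mul_apply, Matrix.mul_apply]
    refine Finset.sum_congr rfl fun c _ => ?_
    rw [diagPart_apply, diagPart_apply]
    rcases lt_trichotomy (β a) (β c) with h1 | h1 | h1
    · rw [hY (show β b < β c by omega), mul_zero, if_neg h1.ne, zero_mul]
    · rw [if_pos h1, if_pos (h1.symm.trans h)]
    · rw [hX h1, zero_mul, if_neg h1.ne', zero_mul]
  · rw [diag_mul diagPart_diag diagPart_diag a b h]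

theorem diagPart_one : diagPart β (1 : Matrix (Fin m) (Fin m) K) = 1 := by
  refine Matrix.ext fun a b => ?_
  rw [diagPart_apply]
  split_ifs with h
  · rfl
  · rw [Matrix.one_apply_ne fun e => h (congrArg β e)]

theorem sub_diagPart_strict (hX : X.BlockTriangular β) (a b : Fin m) (h : β b ≤ β a) :
    (X - diagPart β X) a b = 0 := by
  rw [Matrix.sub_apply, diagPart_apply]
  split_ifs with h1
  · rw [sub_self]
  · rw [hX (show β b < β a by omega), sub_zero]

theorem diagPart_blockTriangular (hX : X.BlockTriangular γ) :
    (diagPart β X).BlockTriangular γ := by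
  intro a b h
  rw [diagPart_apply, hX h, ite_self]

theorem conj_diagPart (σ : Equiv.Perm (Fin m)) :
    (permGL K σ)⁻¹.val * diagPart (β ∘ σ) X * (permGL K σ).val =
      diagPart β ((permGL K σ)⁻¹.val * X * (permGL K σ).val) := by
  refine Matrix.ext fun a b => ?_
  obtain ⟨a, rfl⟩ := σ.surjective a
  obtain ⟨b, rfl⟩ := σ.surjective b
  rw [permGL_conj_apply, diagPart_apply, diagPart_apply, permGL_conj_apply]
  rfl

theorem conj_blockTriangular_iff (σ : Equiv.Perm (Fin m)) :
    ((permGL K σ)⁻¹.val * X * (permGL K σ).val).BlockTriangular β ↔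
      X.BlockTriangular (β ∘ σ) := by
  constructor
  · intro h a b hab
    rw [← permGL_conj_apply σ X]
    exact h hab
  · intro h a b hab
    obtain ⟨a, rfl⟩ := σ.surjective a
    obtain ⟨b, rfl⟩ := σ.surjective b
    rw [permGL_conj_apply]
    exact h hab

end DiagPart

/-! ### Block parabolics of a group closed under block diagonal parts -/

/-- A group and its Lie algebra are closed under taking the block diagonal part of block upper
triangular matrices. -/
structure BlockClosed (G : LiePair k K m) (β : Fin m → ℕ) : Prop where
  lie : ∀ X ∈ G.lie, diagPart β X ∈ G.lie
  grp : ∀ g ∈ G.grp, g.val.BlockTriangular β → ∃ l ∈ G.grp, l.val = diagPart β g.val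

variable {G : LiePair k K m} {β β' : Fin m → ℕ}

theorem inv_mul_sub_one (g l : GL (Fin m) K) : (l⁻¹ * g).val - 1 = l⁻¹.val * (g.val - l.val) := by
  rw [mul_sub, ← Units.val_mul, ← Units.val_mul, inv_mul_cancel, Units.val_one]

namespace BlockClosed

theorem mem_parLie_iff (hβ : BlockClosed G β) (X : Matrix (Fin m) (Fin m) K) :
    X ∈ (blockParabolic G β).parLie ↔ X ∈ G.lie ∧ X.BlockTriangular β := by
  constructor
  · intro h
    obtain ⟨Y, hY, Z, hZ, rfl⟩ := Submodule.mem_sup.1 h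
    exact ⟨G.lie.add_mem hY.1 hZ.1, (diag_triangular hY.2).add (strict_triangular hZ.2)⟩
  · rintro ⟨h1, h2⟩
    exact Parabolic.mem_parLie _ (Y := diagPart β X) ⟨hβ.lie X h1, diagPart_diag⟩
      ⟨G.lie.sub_mem h1 (hβ.lie X h1), sub_diagPart_strict h2⟩

theorem inv_mul_mem_unip {l g : GL (Fin m) K} (hl : l ∈ G.grp) (hg : g ∈ G.grp)
    (hg' : g.val.BlockTriangular β) (e : l.val = diagPart β g.val) :
    l⁻¹ * g ∈ (blockParabolic G β).unip := by
  refine ⟨mul_mem (inv_mem hl) hg, unip_iff.2 ?_⟩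
  rw [inv_mul_sub_one]
  refine mul_strict (inv_triangular l ?_) ?_
  · rw [e]
    exact diagPart_blockTriangular hg'
  · rw [e]
    exact sub_diagPart_strict hg'

theorem mem_P_iff (hβ : BlockClosed G β) (g : GL (Fin m) K) :
    g ∈ (blockParabolic G β).P ↔ g ∈ G.grp ∧ g.val.BlockTriangular β := by
  rw [Parabolic.mem_P_iff]
  constructor
  · rintro ⟨l, hl, u, hu, rfl⟩
    refine ⟨mul_mem hl.1 hu.1, ?_⟩
    rw [Units.val_mul]
    exact (diag_triangular hl.2).mul (unip_triangular (unip_iff.1 hu.2))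
  · rintro ⟨h1, h2⟩
    obtain ⟨l, hl, e⟩ := hβ.grp g h1 h2
    refine ⟨l, ⟨hl, ?_⟩, l⁻¹ * g, inv_mul_mem_unip hl h1 h2 e, mul_inv_cancel_left _ _⟩
    rw [e]
    exact diagPart_diag

theorem Ad_inv_permGL (σ : Equiv.Perm (Fin m)) (X : Matrix (Fin m) (Fin m) K) :
    Ad k (permGL K σ)⁻¹ X = (permGL K σ)⁻¹.val * X * (permGL K σ).val := by
  rw [Ad_apply, inv_inv]

theorem conj_inv_permGL (σ : Equiv.Perm (Fin m)) (g : GL (Fin m) K) :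
    (MulAut.conj (permGL K σ)⁻¹ g).val = (permGL K σ)⁻¹.val * g.val * (permGL K σ).val := by
  rw [MulAut.conj_apply, inv_inv]
  rfl

/-! ### Relative position of two block parabolics under a permutation matrix in G -/

section Position

variable {σ : Equiv.Perm (Fin m)}

/-- The part for `β ∘ σ` is the part for `β` transported by conjugation with w, and w lies in G. -/
theorem diagPart_comp_mem (hβ : BlockClosed G β) (hσ : permGL K σ ∈ G.grp)
    (X : Matrix (Fin m) (Fin m) K) (hX : X ∈ G.lie) : diagPart (β ∘ σ) X ∈ G.lie := by
  have h := G.ad_mem _ hσ _ (hβ.lie _ (G.ad_mem _ (inv_mem hσ) _ hX))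
  rwa [Ad_inv_permGL, ← conj_diagPart, ← Ad_inv_permGL (k := k), Ad_Ad_inv] at h

theorem mem_parLie_conj_iff (hβ : BlockClosed G β) (hσ : permGL K σ ∈ G.grp)
    (X : Matrix (Fin m) (Fin m) K) (hX : X ∈ G.lie) :
    Ad k (permGL K σ)⁻¹ X ∈ (blockParabolic G β).parLie ↔ X.BlockTriangular (β ∘ σ) := by
  rw [hβ.mem_parLie_iff, Ad_inv_permGL, conj_blockTriangular_iff, and_iff_right_iff_imp,
    ← Ad_inv_permGL (k := k)]
  exact fun _ => G.ad_mem _ (inv_mem hσ) _ hX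

theorem levi_component (hβ : BlockClosed G β) (hσ : permGL K σ ∈ G.grp)
    (Y : Matrix (Fin m) (Fin m) K) (hY : Y ∈ (blockParabolic G β').levi.lie)
    (h : Y.BlockTriangular (β ∘ σ)) :
    Y ∈ ((blockParabolic G β').rel (blockParabolic G β) (permGL K σ)⁻¹).parLie := by
  have h0 := hβ.diagPart_comp_mem hσ Y hY.1
  have h1 : diagPart (β ∘ σ) Y ∈ (blockParabolic G β').levi.lie := by
    refine ⟨h0, fun a b hab => ?_⟩
    rw [diagPart_apply, hY.2 a b hab, ite_self]
  refine Parabolic.mem_parLie _ (Y := diagPart (β ∘ σ) Y) ⟨h1, ?_⟩ ⟨?_, ?_⟩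
  · refine ⟨G.ad_mem _ (inv_mem hσ) _ h0, ?_⟩
    change ∀ a b, β a ≠ β b → Ad k (permGL K σ)⁻¹ (diagPart (β ∘ σ) Y) a b = 0
    rw [Ad_inv_permGL, conj_diagPart]
    exact diagPart_diag
  · exact LieSubalgebra.sub_mem _ hY h1
  · refine ⟨G.ad_mem _ (inv_mem hσ) _ (G.lie.sub_mem hY.1 h0), ?_⟩
    change ∀ a b, β b ≤ β a → Ad k (permGL K σ)⁻¹ (Y - diagPart (β ∘ σ) Y) a b = 0
    rw [map_sub, Ad_inv_permGL, Ad_inv_permGL, conj_diagPart]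
    exact sub_diagPart_strict ((conj_blockTriangular_iff σ).2 h)

/-- Y lives inside the `β'`-blocks and Z strictly above them. Their supports are disjoint, so
triangularity of Y + Z for `β ∘ σ` is inherited by each summand. -/
theorem add_mem_parLie (hβ : BlockClosed G β) (hσ : permGL K σ ∈ G.grp)
    (Y : Matrix (Fin m) (Fin m) K) (hY : Y ∈ (blockParabolic G β').levi.lie)
    (Z : Matrix (Fin m) (Fin m) K) (hZ : Z ∈ (blockParabolic G β').nil)
    (h : Ad k (permGL K σ)⁻¹ (Y + Z) ∈ (blockParabolic G β).parLie) :
    Y ∈ ((blockParabolic G β').rel (blockParabolic G β) (permGL K σ)⁻¹).parLie ∧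
      Ad k (permGL K σ)⁻¹ Z ∈ (blockParabolic G β).parLie := by
  have h1 := (hβ.mem_parLie_conj_iff hσ _ (G.lie.add_mem hY.1 hZ.1)).1 h
  have h2 : Y.BlockTriangular (β ∘ σ) := by
    intro a b hab
    by_cases hab' : β' a = β' b
    · have := h1 hab
      rwa [Matrix.add_apply, hZ.2 a b hab'.ge, add_zero] at this
    · exact hY.2 a b hab'
  refine ⟨hβ.levi_component hσ Y hY h2, (hβ.mem_parLie_conj_iff hσ _ hZ.1).2 ?_⟩
  have := h1.sub h2
  rwa [add_sub_cancel_left] at this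

/-- The summand in 𝔩 is the block diagonal part of w⁻¹Zw. Conjugated back, it is Z with some entries
deleted, hence still in 𝔲'. -/
theorem nil_component (hβ : BlockClosed G β) (hσ : permGL K σ ∈ G.grp)
    (Z : Matrix (Fin m) (Fin m) K) (hZ : Z ∈ (blockParabolic G β').nil)
    (h : Ad k (permGL K σ)⁻¹ Z ∈ (blockParabolic G β).parLie) :
    ∃ A ∈ ((blockParabolic G β).rel (blockParabolic G β') (permGL K σ)).nil,
      Ad k (permGL K σ)⁻¹ Z - A ∈ (blockParabolic G β).nil := by
  have h1 := (hβ.mem_parLie_iff _).1 h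
  have h2 := hβ.diagPart_comp_mem hσ Z hZ.1
  have h3 := hβ.lie _ h1.1
  refine ⟨diagPart β (Ad k (permGL K σ)⁻¹ Z), ⟨⟨h3, diagPart_diag⟩, ?_⟩,
    G.lie.sub_mem h1.1 h3, sub_diagPart_strict h1.2⟩
  change Ad k (permGL K σ) _ ∈ (blockParabolic G β').nil
  rw [Ad_inv_permGL, ← conj_diagPart, ← Ad_inv_permGL (k := k), Ad_Ad_inv]
  refine ⟨h2, fun a b hab => ?_⟩
  rw [diagPart_apply, hZ.2 a b hab, ite_self]

theorem mem_P_conj_iff (hβ : BlockClosed G β) (hσ : permGL K σ ∈ G.grp) (g : GL (Fin m) K)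
    (hg : g ∈ G.grp) : MulAut.conj (permGL K σ)⁻¹ g ∈ (blockParabolic G β).P ↔
      g.val.BlockTriangular (β ∘ σ) := by
  rw [hβ.mem_P_iff, conj_inv_permGL, conj_blockTriangular_iff, and_iff_right_iff_imp]
  intro _
  rw [MulAut.conj_apply]
  exact mul_mem (mul_mem (inv_mem hσ) hg) (inv_mem (inv_mem hσ))

/-- This says P'_w = L' ∩ wPw⁻¹: the Levi decomposition of w⁻¹gw in P, conjugated back by w, stays
inside L'. -/
theorem mem_rel_P_iff (hβ : BlockClosed G β) (hσ : permGL K σ ∈ G.grp) (g : GL (Fin m) K) :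
    g ∈ ((blockParabolic G β').rel (blockParabolic G β) (permGL K σ)⁻¹).P ↔
      g ∈ (blockParabolic G β').levi.grp ∧ g.val.BlockTriangular (β ∘ σ) := by
  constructor
  · intro h
    have h1 := Parabolic.P_le _ h
    refine ⟨h1, (hβ.mem_P_conj_iff hσ g h1.1).1 ?_⟩
    obtain ⟨l, hl, u, hu, rfl⟩ := (Parabolic.mem_P_iff _ _).1 h
    rw [map_mul]
    exact mul_mem (Parabolic.levi_le_P _ hl.2) (Parabolic.unip_le_P _ hu.2)
  · rintro ⟨h1, h2⟩
    have h3 := ((hβ.mem_P_iff _).1 ((hβ.mem_P_conj_iff hσ g h1.1).2 h2))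
    obtain ⟨l, hl, e⟩ := hβ.grp _ h3.1 h3.2
    have e1 : (MulAut.conj (permGL K σ)⁻¹) (MulAut.conj (permGL K σ) l) = l := by
      simp [MulAut.conj_apply, mul_assoc]
    -- The Levi factor of g is its block diagonal part for `β ∘ σ`; it arises from g by deleting
    -- entries, so it remains block diagonal for `β'`.
    have e2 : (MulAut.conj (permGL K σ) l).val = diagPart (β ∘ σ) g.val := by
      have h4 := (conj_inv_permGL σ (MulAut.conj (permGL K σ) l)).symm
      rw [e1, e, conj_inv_permGL, ← conj_diagPart] at h4
      have h5 := (Units.mul_left_inj (permGL K σ)).1 h4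
      exact (Units.mul_right_inj (permGL K σ)⁻¹).1 h5
    have h6 : MulAut.conj (permGL K σ) l ∈ (blockParabolic G β').levi.grp := by
      refine ⟨mul_mem (mul_mem hσ hl) (inv_mem hσ), fun a b hab => ?_⟩
      rw [e2, diagPart_apply, h1.2 a b hab, ite_self]
    refine (Parabolic.mem_P_iff _ _).2 ⟨MulAut.conj (permGL K σ) l, ⟨h6, ?_, ?_⟩,
      (MulAut.conj (permGL K σ) l)⁻¹ * g, ⟨Subgroup.mul_mem _ (Subgroup.inv_mem _ h6) h1, ?_⟩,
      mul_inv_cancel_left _ _⟩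
    · change MulAut.conj (permGL K σ)⁻¹ (MulAut.conj (permGL K σ) l) ∈ G.grp
      rwa [e1]
    · change ∀ a b, β a ≠ β b →
        (MulAut.conj (permGL K σ)⁻¹ (MulAut.conj (permGL K σ) l)).val a b = 0
      rw [e1, e]
      exact diagPart_diag
    · change MulAut.conj (permGL K σ)⁻¹ ((MulAut.conj (permGL K σ) l)⁻¹ * g) ∈
        (blockParabolic G β).unip
      rw [map_mul, map_inv, e1]
      exact inv_mul_mem_unip hl h3.1 h3.2 e

/-- In the factorization g = lu of P', the factor l is g with entries deleted, so it is triangular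
for `β ∘ σ` if g is, and then so is u = l⁻¹g. Thus P' ∩ wPw⁻¹ is in bijection with P'_w × (U' ∩
wPw⁻¹), and `hcard` replaces the second factor by its Lie algebra analogue. -/
theorem card_inf_eq (hβ : BlockClosed G β) (hβ' : BlockClosed G β') (hσ : permGL K σ ∈ G.grp)
    (hcard : ∀ γ : Fin m → ℕ,
      Nat.card {g // g ∈ (blockParabolic G β').unip ∧ g.val.BlockTriangular γ} =
        Nat.card {X // X ∈ (blockParabolic G β').nil ∧ X.BlockTriangular γ}) :
    Nat.card ((blockParabolic G β').P ⊓ (blockParabolic G β).P.comap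
        (MulAut.conj (permGL K σ)⁻¹).toMonoidHom : Subgroup (GL (Fin m) K)) =
      Nat.card ((blockParabolic G β').rel (blockParabolic G β) (permGL K σ)⁻¹).P *
        Nat.card (Parabolic.nilInf (blockParabolic G β) (blockParabolic G β') (permGL K σ)) := by
  have e1 : Nat.card (Parabolic.nilInf (blockParabolic G β) (blockParabolic G β')
      (permGL K σ)) = Nat.card {X // X ∈ (blockParabolic G β').nil ∧
        X.BlockTriangular (β ∘ σ)} := by
    refine Nat.card_congr (Equiv.subtypeEquivRight fun X => ?_)
    exact and_congr_right fun hX => hβ.mem_parLie_conj_iff hσ X hX.1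
  rw [e1, ← hcard, ← Nat.card_prod]
  have hmem : ∀ g, g ∈ ((blockParabolic G β').P ⊓ (blockParabolic G β).P.comap
      (MulAut.conj (permGL K σ)⁻¹).toMonoidHom : Subgroup (GL (Fin m) K)) ↔
      g ∈ (blockParabolic G β').P ∧ g.val.BlockTriangular (β ∘ σ) := fun g =>
    and_congr_right fun hg => hβ.mem_P_conj_iff hσ g (Parabolic.P_le _ hg)
  symm
  refine Nat.card_eq_of_bijective (fun x => ⟨x.1.1 * x.2.1, ?_⟩) ⟨?_, ?_⟩
  · have h := (hβ.mem_rel_P_iff hσ _).1 x.1.2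
    refine (hmem _).2 ⟨mul_mem (Parabolic.levi_le_P _ h.1) (Parabolic.unip_le_P _ x.2.2.1), ?_⟩
    rw [Units.val_mul]
    exact h.2.mul x.2.2.2
  · rintro ⟨⟨l, hl⟩, u, hu⟩ ⟨⟨l', hl'⟩, u', hu'⟩ h
    have h : l * u = l' * u' := congrArg (fun x => x.1) h
    have h1 := ((hβ.mem_rel_P_iff hσ _).1 hl).1
    have h1' := ((hβ.mem_rel_P_iff hσ _).1 hl').1
    have h2 := (blockParabolic G β').mulEquiv.injective (a₁ := (⟨l, h1⟩, ⟨u, hu.1⟩))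
      (a₂ := (⟨l', h1'⟩, ⟨u', hu'.1⟩)) (Subtype.ext h)
    obtain rfl : l = l' := congrArg (fun x => x.1.1) h2
    obtain rfl : u = u' := congrArg (fun x => x.2.1) h2
    rfl
  · rintro ⟨g, hg⟩
    obtain ⟨hg1, hg2⟩ := (hmem g).1 hg
    rw [hβ'.mem_P_iff] at hg1
    obtain ⟨l, hl, e⟩ := hβ'.grp g hg1.1 hg1.2
    have h3 : l.val.BlockTriangular (β ∘ σ) := by
      rw [e]
      exact diagPart_blockTriangular hg2
    refine ⟨(⟨l, (hβ.mem_rel_P_iff hσ _).2 ⟨⟨hl, ?_⟩, h3⟩⟩,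
      ⟨l⁻¹ * g, inv_mul_mem_unip hl hg1.1 hg1.2 e, ?_⟩), Subtype.ext (mul_inv_cancel_left _ _)⟩
    · rw [e]
      exact diagPart_diag
    · rw [Units.val_mul]
      exact (inv_triangular l h3).mul hg2

end Position

/-- Mackey's formula for two block parabolics, for representatives of `P' \ G / P` in `W`. -/
theorem mackey [Finite K] (hβ : BlockClosed G β) (hβ' : BlockClosed G β')
    (hcard : ∀ γ : Fin m → ℕ,
      Nat.card {g // g ∈ (blockParabolic G β').unip ∧ g.val.BlockTriangular γ} =
        Nat.card {X // X ∈ (blockParabolic G β').nil ∧ X.BlockTriangular γ})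
    (R : Finset (GL (Fin m) K)) (hW : ∀ r ∈ R, r ∈ weyl G)
    (hR : ∀ g ∈ G.grp, ∃! r, r ∈ R ∧ g ∈ DoubleCoset.doubleCoset r
      ((blockParabolic G β').P : Set (GL (Fin m) K))
      ((blockParabolic G β).P : Set (GL (Fin m) K))) :
    (blockParabolic G β').res ∘ₗ (blockParabolic G β).ind = ∑ w ∈ R,
      ((blockParabolic G β').rel (blockParabolic G β) w⁻¹).ind ∘ₗ
        ((blockParabolic G β).T (blockParabolic G β') w).toLinearMap ∘ₗ
        ((blockParabolic G β).rel (blockParabolic G β') w).res := by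
  refine Parabolic.mackey _ _ R hR (fun r hr => (hW r hr).1) ?_ ?_ ?_ ?_
  -- For constant `γ` triangularity is no condition, and `hcard` becomes |U'| = |𝔲'|.
  · have h : ∀ X : Matrix (Fin m) (Fin m) K, X.BlockTriangular (fun _ => 0) :=
      fun X a b hab => absurd hab (lt_irrefl 0)
    have := hcard fun _ => 0
    simpa only [h, and_true] using this
  · intro w hw
    obtain ⟨σ, rfl, hσ⟩ := (mem_weyl_iff w).1 (hW w hw)
    exact hβ.card_inf_eq hβ' hσ hcard
  · intro w hw
    obtain ⟨σ, rfl, hσ⟩ := (mem_weyl_iff w).1 (hW w hw)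
    exact hβ.add_mem_parLie hσ
  · intro w hw
    obtain ⟨σ, rfl, hσ⟩ := (mem_weyl_iff w).1 (hW w hw)
    exact hβ.nil_component hσ

end BlockClosed

end MackeyLie

end
noncomputable section

namespace MackeyLie

attribute [local instance] LieRing.ofAssociativeRing

/-! ### Matching colourings by permutations, with and without an involution -/

section Matching

/-- Two colourings whose colour classes have the same sizes differ by a permutation. -/
theorem exists_perm_comp_eq {X C : Type*} [Finite X] (A B : X → C)
    (h : ∀ c, Nat.card {x // A x = c} = Nat.card {x // B x = c}) :
    ∃ τ : Equiv.Perm X, ∀ x, B (τ x) = A x :=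
  ⟨Equiv.ofFiberEquiv fun c => Classical.choice (Finite.card_eq.1 (h c)),
    fun x => Equiv.ofFiberEquiv_map _ x⟩

/-- For an involution `ρ` without fixed points and `a ≠ b` there is a permutation that commutes
with `ρ`, maps `a` to `b`, and moves only `a`, `b`, `ρ a`, `ρ b`. -/
theorem exists_commuting_swap {X : Type*} (ρ : Equiv.Perm X) (hρ : ∀ x, ρ (ρ x) = x)
    (hfix : ∀ x, ρ x ≠ x) (a b : X) (hab : a ≠ b) :
    ∃ s : Equiv.Perm X, (∀ x, s (ρ x) = ρ (s x)) ∧ s a = b ∧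
      ∀ x, x ≠ a → x ≠ b → x ≠ ρ a → x ≠ ρ b → s x = x := by
  classical
  have hs : ∀ x y, ρ * Equiv.swap x y = Equiv.swap (ρ x) (ρ y) * ρ := fun x y => by
    rw [Equiv.swap_apply_apply, inv_mul_cancel_right]
  -- If b = ρ a, the transposition (a b) already commutes with ρ. Otherwise (a b) and (ρa ρb) are
  -- disjoint and ρ interchanges them, so their product commutes with ρ.
  by_cases hb : b = ρ a
  · subst hb
    refine ⟨Equiv.swap a (ρ a), fun x => ?_, Equiv.swap_apply_left _ _,
      fun x h1 h2 _ _ => Equiv.swap_apply_of_ne_of_ne h1 h2⟩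
    have h := congrArg (fun f : Equiv.Perm X => f x) (hs a (ρ a))
    rw [hρ, Equiv.swap_comm (ρ a) a] at h
    exact h.symm
  · have h1 : ρ b ≠ a := fun h => hb (by rw [← h, hρ])
    have h2 : ρ a ≠ ρ b := fun h => hab (ρ.injective h)
    have hcomm : Equiv.swap a b * Equiv.swap (ρ a) (ρ b) =
        Equiv.swap (ρ a) (ρ b) * Equiv.swap a b := by
      refine (Equiv.Perm.Disjoint.commute fun x => ?_).eq
      by_cases hx : x = a ∨ x = b
      · refine Or.inr (Equiv.swap_apply_of_ne_of_ne ?_ ?_)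
        · rcases hx with rfl | rfl
          · exact (hfix x).symm
          · exact hb
        · rcases hx with rfl | rfl
          · exact h1.symm
          · exact (hfix x).symm
      · rw [not_or] at hx
        exact Or.inl (Equiv.swap_apply_of_ne_of_ne hx.1 hx.2)
    refine ⟨Equiv.swap a b * Equiv.swap (ρ a) (ρ b), fun x => ?_, ?_, fun x h3 h4 h5 h6 => ?_⟩
    · have h : ρ * (Equiv.swap a b * Equiv.swap (ρ a) (ρ b)) =
          (Equiv.swap a b * Equiv.swap (ρ a) (ρ b)) * ρ := by
        rw [← mul_assoc, hs, mul_assoc, hs, hρ, hρ, ← mul_assoc, hcomm]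
      exact (congrArg (fun f : Equiv.Perm X => f x) h).symm
    · rw [Equiv.Perm.mul_apply, Equiv.swap_apply_of_ne_of_ne (hfix a).symm h1.symm,
        Equiv.swap_apply_left]
    · rw [Equiv.Perm.mul_apply, Equiv.swap_apply_of_ne_of_ne h5 h6,
        Equiv.swap_apply_of_ne_of_ne h3 h4]

/-- Two colourings that are equivariant for an involution without fixed points, and whose colour
classes have the same sizes, differ by an equivariant permutation. -/
theorem exists_commuting_perm_comp_eq {X C : Type*} [Finite X] (ρ : Equiv.Perm X)
    (hρ : ∀ x, ρ (ρ x) = x) (hfix : ∀ x, ρ x ≠ x) (ι : C → C) (hι : ∀ x, ι (ι x) = x)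
    (A : X → C) (hA : ∀ x, A (ρ x) = ι (A x)) (B : X → C) (hB : ∀ x, B (ρ x) = ι (B x))
    (h : ∀ c, Nat.card {x // A x = c} = Nat.card {x // B x = c}) :
    ∃ τ : Equiv.Perm X, (∀ x, τ (ρ x) = ρ (τ x)) ∧ ∀ x, B (τ x) = A x := by
  induction hn : Set.ncard {x | B x ≠ A x} using Nat.strong_induction_on generalizing B with
  | h n ih =>
    by_cases hAB : ∀ x, B x = A x
    · exact ⟨1, fun _ => rfl, hAB⟩
    · push Not at hAB
      obtain ⟨a, ha⟩ := hAB
      -- Otherwise the class of colour A a under B would be contained in the one under A and miss a,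
      -- although both have the same size.
      obtain ⟨b, hb, hb'⟩ : ∃ b, B b = A a ∧ A b ≠ A a := by
        by_contra! hcon
        have h1 : {x | B x = A a} ⊂ {x | A x = A a} :=
          (Set.ssubset_iff_of_subset fun x hx => hcon x hx).2 ⟨a, rfl, ha⟩
        exact (Set.ncard_lt_ncard h1).ne (h (A a)).symm
      have hmis : ∀ x, B x ≠ A x → B (ρ x) ≠ A (ρ x) := fun x hx hx' => hx (by
        rw [hA, hB] at hx'
        rw [← hι (B x), hx', hι])
      have hbm : B b ≠ A b := fun hx => hb' (hx ▸ hb)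
      obtain ⟨s, hs, hsa, hsf⟩ := exists_commuting_swap ρ hρ hfix a b fun e => hb' (e ▸ rfl)
      -- The swap moves only a, b, ρa and ρb, all of them mismatched before, and it repairs a; so
      -- the number of mismatches drops.
      have hlt : Set.ncard {x | B (s x) ≠ A x} < n := by
        rw [← hn]
        have hsub : {x | B (s x) ≠ A x} ⊆ {x | B x ≠ A x} := by
          intro x hx hx'
          refine hx ?_
          rw [hsf x, hx']
          · rintro rfl; exact ha hx'
          · rintro rfl; exact hbm hx'
          · rintro rfl; exact hmis a ha hx'
          · rintro rfl; exact hmis b hbm hx'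
        exact Set.ncard_lt_ncard ((Set.ssubset_iff_of_subset hsub).2
          ⟨a, ha, fun hx => hx (by rw [hsa, hb])⟩)
      obtain ⟨τ, hτ, hτ'⟩ := ih _ hlt (fun x => B (s x)) (fun x => by rw [hs, hB])
        (fun c => (h c).trans (Nat.card_congr (s.subtypeEquiv fun x => by simp).symm)) rfl
      exact ⟨s * τ, fun x => by simp [hτ, hs], hτ'⟩

end Matching

variable {K : Type*} [Field K] {m : ℕ}

/-! ### Rank invariants of double cosets -/

section Counting

variable {β β' : Fin m → ℕ} {σ τ : Equiv.Perm (Fin m)} {p p' : GL (Fin m) K}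

/-- A lower left corner of the matrix of τ contains an identity matrix. Block triangularity of p'
and p kills every term of the product p'σp outside the corresponding corner of σ. So the identity
factors through a space whose dimension is the number of ones in the corner of σ, and ranks give the
inequality. -/
theorem card_corner_le (hp' : p'.val.BlockTriangular β') (hp : p.val.BlockTriangular β)
    (h : permGL K τ = p' * permGL K σ * p) (x y : ℕ) :
    Nat.card {a // x ≤ β' a ∧ β (τ a) < y} ≤ Nat.card {a // x ≤ β' a ∧ β (σ a) < y} := by
  classical
  let M : Matrix {a // x ≤ β' a ∧ β (τ a) < y} {a // x ≤ β' a ∧ β (σ a) < y} K :=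
    Matrix.of fun a c => p'.val a.1 c.1
  let N : Matrix {a // x ≤ β' a ∧ β (σ a) < y} {a // x ≤ β' a ∧ β (τ a) < y} K :=
    Matrix.of fun c a => p.val (σ c.1) (τ a.1)
  have e : M * N = 1 := by
    refine Matrix.ext fun a b => ?_
    have h1 : (permGL K τ).val a.1 (τ b.1) = (1 : Matrix _ _ K) a b := by
      rw [permGL_apply, Matrix.one_apply]
      simp only [τ.injective.eq_iff, Subtype.ext_iff]
    rw [← h1, h, mul_assoc, Units.val_mul, Units.val_mul, Matrix.mul_apply, Matrix.mul_apply]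
    refine Finset.sum_of_injOn (fun c => c.1) Subtype.val_injective.injOn
      (fun _ _ => Finset.mem_coe.2 (Finset.mem_univ _)) (fun c _ hc => ?_) (fun c _ => ?_)
    · rw [permGL_mul_apply]
      by_cases h2 : x ≤ β' c
      · by_cases h3 : β (σ c) < y
        · exact absurd ⟨⟨c, h2, h3⟩, Finset.mem_coe.2 (Finset.mem_univ _), rfl⟩ hc
        · rw [hp (lt_of_lt_of_le b.2.2 (not_lt.1 h3)), mul_zero]
      · rw [hp' (lt_of_lt_of_le (not_le.1 h2) a.2.1), zero_mul]
    · rw [permGL_mul_apply]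
      rfl
  have h4 : (1 : Matrix {a // x ≤ β' a ∧ β (τ a) < y} _ K).rank ≤
      Fintype.card {a // x ≤ β' a ∧ β (σ a) < y} :=
    e ▸ (Matrix.rank_mul_le_left M N).trans (Matrix.rank_le_card_width M)
  rw [Matrix.rank_one] at h4
  rwa [Nat.card_eq_fintype_card, Nat.card_eq_fintype_card]

theorem card_corner_eq (hp' : p'.val.BlockTriangular β') (hp : p.val.BlockTriangular β)
    (h : permGL K τ = p' * permGL K σ * p) (x y : ℕ) :
    Nat.card {a // x ≤ β' a ∧ β (τ a) < y} = Nat.card {a // x ≤ β' a ∧ β (σ a) < y} := by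
  refine le_antisymm (card_corner_le hp' hp h x y)
    (card_corner_le (inv_triangular _ hp') (inv_triangular _ hp) ?_ x y)
  rw [h]
  group

/-- Inclusion–exclusion: one cell is an alternating sum of four corners, with the negative terms
moved to the left to stay in ℕ. -/
theorem card_cell_add (f g : Fin m → ℕ) (x y : ℕ) :
    Nat.card {a // (f a, g a) = (x, y)} + Nat.card {a // x + 1 ≤ f a ∧ g a < y + 1} +
      Nat.card {a // x ≤ f a ∧ g a < y} =
    Nat.card {a // x ≤ f a ∧ g a < y + 1} + Nat.card {a // x + 1 ≤ f a ∧ g a < y} := by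
  simp only [Nat.card_eq_fintype_card, Fintype.card_subtype, Finset.card_filter, Prod.mk.injEq]
  rw [← Finset.sum_add_distrib, ← Finset.sum_add_distrib, ← Finset.sum_add_distrib]
  refine Finset.sum_congr rfl fun a _ => ?_
  split_ifs <;> omega

/-- The number of entries `1` of a permutation matrix in each block is an invariant of the
double coset of the permutation matrix modulo block triangular matrices. -/
theorem card_cell_eq (hp' : p'.val.BlockTriangular β') (hp : p.val.BlockTriangular β)
    (h : permGL K τ = p' * permGL K σ * p) (c : ℕ × ℕ) :
    Nat.card {a // (β' a, β (σ a)) = c} = Nat.card {a // (β' a, β (τ a)) = c} := by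
  obtain ⟨x, y⟩ := c
  have h1 := card_cell_add β' (fun a => β (σ a)) x y
  have h2 := card_cell_add β' (fun a => β (τ a)) x y
  have e := card_corner_eq hp' hp h
  rw [← e, ← e, ← e, ← e] at h1
  omega

end Counting

/-! ### The refined Bruhat decomposition of GL and its uniqueness -/

section Bruhat

/-- Gaussian elimination: all pivot positions of S are cleared from left to right, since a vector
with leading position j does not disturb the entries before j. -/
theorem exists_add_pivot_eq_zero (S : Submodule K (Fin m → K)) (x : Fin m → K) :
    ∃ s ∈ S, ∀ j, (∃ v ∈ S, v j ≠ 0 ∧ ∀ i < j, v i = 0) → (x + s) j = 0 := by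
  have h : ∀ n, ∃ s ∈ S, ∀ j : Fin m, j.val < n →
      (∃ v ∈ S, v j ≠ 0 ∧ ∀ i < j, v i = 0) → (x + s) j = 0 := by
    intro n
    induction n with
    | zero => exact ⟨0, S.zero_mem, fun j hj => absurd hj (Nat.not_lt_zero _)⟩
    | succ n ih =>
      obtain ⟨s, hs, h⟩ := ih
      by_cases hn : ∃ j : Fin m, j.val = n ∧ ∃ v ∈ S, v j ≠ 0 ∧ ∀ i < j, v i = 0
      · obtain ⟨j, hj, v, hv, hvj, hv0⟩ := hn
        refine ⟨s - ((x + s) j / v j) • v, S.sub_mem hs (S.smul_mem _ hv), fun i hi hp => ?_⟩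
        rcases Nat.lt_succ_iff_lt_or_eq.1 hi with hi | hi
        · have h1 := h i hi hp
          rw [Pi.add_apply] at h1
          rw [Pi.add_apply, Pi.sub_apply, Pi.smul_apply, hv0 i (Fin.lt_def.2 (hj ▸ hi)),
            smul_zero, sub_zero, h1]
        · obtain rfl : i = j := Fin.ext (hi.trans hj.symm)
          rw [Pi.add_apply, Pi.sub_apply, Pi.smul_apply, Pi.add_apply, smul_eq_mul]
          field_simp
          ring
      · refine ⟨s, hs, fun i hi hp => ?_⟩
        rcases Nat.lt_succ_iff_lt_or_eq.1 hi with hi | hi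
        · exact h i hi hp
        · exact absurd ⟨i, hi, hp⟩ hn
  obtain ⟨s, hs, h⟩ := h m
  exact ⟨s, hs, fun j => h j j.2⟩

/-- An upper triangular matrix with non-zero diagonal is invertible. -/
theorem exists_units_val_eq (X : Matrix (Fin m) (Fin m) K)
    (hX : X.BlockTriangular (fun a : Fin m => a.val)) (hd : ∀ a, X a a ≠ 0) :
    ∃ g : GL (Fin m) K, g.val = X := by
  have h : X.det ≠ 0 := by
    rw [Matrix.det_of_isUpperTriangular (show X.BlockTriangular id from fun a b hab => hX hab)]
    exact Finset.prod_ne_zero_iff.2 fun a _ => hd a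
  exact ⟨Matrix.GeneralLinearGroup.mkOfDetNeZero X h, rfl⟩

/-- The data of the refined Bruhat decomposition `g = b w u`: `b` is upper triangular, `u` is upper
unitriangular, and `w u w⁻¹` is lower triangular. -/
structure IsBruhat (b : GL (Fin m) K) (σ : Equiv.Perm (Fin m)) (u : GL (Fin m) K) : Prop where
  left : b.val.BlockTriangular (fun a : Fin m => a.val)
  unip : ∀ a b : Fin m, b.val ≤ a.val → (u.val - 1) a b = 0
  lower : u.val.BlockTriangular (OrderDual.toDual ∘ σ.symm)

theorem exists_bruhat (g : GL (Fin m) K) : ∃ b σ u, IsBruhat b σ u ∧ b * permGL K σ * u = g := by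
  classical
  -- S a is spanned by the rows of g below row a. Modulo S a, row a is reduced at all pivots of S a;
  -- the permutation sends a to the leading position of the reduced row.
  let S : Fin m → Submodule K (Fin m → K) := fun a => Submodule.span K (g.val '' {c | a < c})
  have hS : ∀ a c, a < c → g.val c ∈ S a := fun a c h => Submodule.subset_span ⟨c, h, rfl⟩
  have hS' : ∀ a c, a < c → S c ≤ S a := fun a c h =>
    Submodule.span_mono (Set.image_mono fun d hd => h.trans hd)
  have hgS : ∀ a, g.val a ∉ S a := fun a =>
    (Matrix.linearIndependent_rows_of_isUnit g.isUnit).notMem_span_image (lt_irrefl a)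
  choose s hs hred using fun a => exists_add_pivot_eq_zero (S a) (g.val a)
  have hlead : ∀ a, ∃ j, (g.val a + s a) j ≠ 0 ∧ ∀ i < j, (g.val a + s a) i = 0 := by
    intro a
    have hne : ∃ j, (g.val a + s a) j ≠ 0 := by
      by_contra! h
      refine hgS a ?_
      rw [eq_neg_of_add_eq_zero_left (funext h)]
      exact (S a).neg_mem (hs a)
    obtain ⟨j, hj, hmin⟩ := WellFounded.has_min (wellFounded_lt (α := Fin m))
      {j | (g.val a + s a) j ≠ 0} hne
    exact ⟨j, hj, fun i hi => by_contra fun h => hmin i h hi⟩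
  choose π hπ hπ0 using hlead
  have hrow : ∀ a c, a < c → g.val c + s c ∈ S a := fun a c h =>
    (S a).add_mem (hS a c h) (hS' a c h (hs c))
  -- The reduced row c lies in S a, so its leading position is a pivot of S a, where the reduced row
  -- a vanishes. This gives injectivity of π and, at the end, the lower triangularity of wuw⁻¹.
  have hpiv : ∀ a c, a < c → (g.val a + s a) (π c) = 0 := fun a c h =>
    hred a (π c) ⟨_, hrow a c h, hπ c, hπ0 c⟩
  have hinj : Function.Injective π := by
    intro a c hac
    rcases lt_trichotomy a c with h | h | h
    · exact absurd (hac ▸ hpiv a c h) (hπ a)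
    · exact h
    · exact absurd (hac ▸ hpiv c a h) (hπ c)
  let σ : Equiv.Perm (Fin m) := Equiv.ofBijective π (Finite.injective_iff_bijective.1 hinj)
  let r : Fin m → Fin m → K := fun a => ((g.val a + s a) (π a))⁻¹ • (g.val a + s a)
  have hr1 : ∀ a, r a (π a) = 1 := fun a => inv_mul_cancel₀ (hπ a)
  have hr0 : ∀ a i, i < π a → r a i = 0 := fun a i hi => by
    change _ * (g.val a + s a) i = 0
    rw [hπ0 a i hi, mul_zero]
  have hσπ : ∀ a, π (σ.symm a) = a := σ.apply_symm_apply
  -- Sorting the normalized reduced rows by leading position yields an upper unitriangular matrix.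
  obtain ⟨u, hu⟩ := exists_units_val_eq (Matrix.of fun a j => r (σ.symm a) j)
    (fun a j haj => hr0 _ _ (by rw [hσπ]; exact haj))
    (fun a => by
      have := hr1 (σ.symm a)
      rw [hσπ] at this
      rw [Matrix.of_apply, this]
      exact one_ne_zero)
  -- Multiplication by g⁻¹ sends row c of g to the standard vector e_c, so combinations of rows c ≥
  -- a are supported in positions ≥ a.
  have hspan : ∀ a, ∀ v ∈ Submodule.span K (g.val '' {c | a ≤ c}), ∀ j < a,
      (v ᵥ* g⁻¹.val) j = 0 := by
    intro a v hv j hj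
    induction hv using Submodule.span_induction with
    | mem v hv =>
      obtain ⟨c, hc, rfl⟩ := hv
      have h : (g.val * g⁻¹.val) c j = 0 := by
        rw [← Units.val_mul, mul_inv_cancel, Units.val_one]
        exact Matrix.one_apply_ne (hj.trans_le hc).ne'
      exact h
    | zero => rw [Matrix.zero_vecMul, Pi.zero_apply]
    | add v w _ _ h1 h2 => rw [Matrix.add_vecMul, Pi.add_apply, h1, h2, add_zero]
    | smul c v _ h1 => rw [Matrix.smul_vecMul, Pi.smul_apply, h1, smul_zero]
  have hc : (permGL K σ * u * g⁻¹).val.BlockTriangular (fun a : Fin m => a.val) := by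
    intro a j hj
    have h1 : (permGL K σ * u * g⁻¹).val a j = (r a ᵥ* g⁻¹.val) j := by
      rw [Units.val_mul, Units.val_mul]
      change ∑ c, ((permGL K σ).val * u.val) a c * g⁻¹.val c j = ∑ c, r a c * g⁻¹.val c j
      refine Finset.sum_congr rfl fun c _ => ?_
      rw [permGL_mul_apply, hu, Matrix.of_apply, Equiv.symm_apply_apply]
    have h2 : g.val a ∈ Submodule.span K (g.val '' {c | a ≤ c}) :=
      Submodule.subset_span ⟨a, le_refl a, rfl⟩
    have h3 : s a ∈ Submodule.span K (g.val '' {c | a ≤ c}) :=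
      Submodule.span_mono (Set.image_mono fun d (hd : a < d) => hd.le) (hs a)
    rw [h1]
    exact hspan a (r a) (Submodule.smul_mem _ _ (Submodule.add_mem _ h2 h3)) j hj
  refine ⟨(permGL K σ * u * g⁻¹)⁻¹, σ, u, ⟨inv_triangular _ hc, ?_, ?_⟩, by group⟩
  · intro a b hab
    rw [hu, Matrix.sub_apply, Matrix.of_apply, sub_eq_zero]
    rcases (Fin.le_def.2 hab).lt_or_eq with h | rfl
    · rw [hr0 _ _ (by rwa [hσπ]), Matrix.one_apply_ne h.ne']
    · have := hr1 (σ.symm b)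
      rw [hσπ] at this
      rw [this, Matrix.one_apply_eq]
  · intro a b hab
    have h1 := hpiv _ _ (show σ.symm a < σ.symm b from hab)
    rw [hσπ] at h1
    rw [hu]
    change _ * (g.val (σ.symm a) + s (σ.symm a)) b = 0
    rw [h1, mul_zero]

/-- Once the permutations agree, b'⁻¹b is upper triangular and equals w(u'u⁻¹)w⁻¹, which is lower
triangular with ones on the diagonal; hence it is 1. -/
theorem IsBruhat.unique {b b' : GL (Fin m) K} {σ σ' : Equiv.Perm (Fin m)} {u u' : GL (Fin m) K}
    (h : IsBruhat b σ u) (h' : IsBruhat b' σ' u')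
    (e : b * permGL K σ * u = b' * permGL K σ' * u') : b = b' ∧ σ = σ' ∧ u = u' := by
  have hb : (b'⁻¹ * b).val.BlockTriangular (fun a : Fin m => a.val) := by
    rw [Units.val_mul]
    exact (inv_triangular _ h'.left).mul h.left
  have hu : (u * u'⁻¹).val.BlockTriangular (fun a : Fin m => a.val) := by
    rw [Units.val_mul]
    exact (unip_triangular h.unip).mul (inv_triangular _ (unip_triangular h'.unip))
  have e1 : permGL K σ' = b'⁻¹ * b * permGL K σ * (u * u'⁻¹) := by
    calc permGL K σ' = b'⁻¹ * (b' * permGL K σ' * u') * u'⁻¹ := by group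
      _ = _ := by rw [← e]; group
  -- With blocks of size one, the cell counts are the entries of the permutation matrix.
  obtain rfl : σ = σ' := by
    refine Equiv.ext fun a => Fin.ext ?_
    have h1 := card_cell_eq hb hu e1 (a.val, (σ a).val)
    have h2 : 0 < Nat.card {x : Fin m // (x.val, (σ x).val) = (a.val, (σ a).val)} :=
      Nat.card_pos_iff.2 ⟨⟨⟨a, rfl⟩⟩, inferInstance⟩
    rw [h1] at h2
    obtain ⟨⟨⟨x, hx⟩⟩, -⟩ := Nat.card_pos_iff.1 h2
    rw [Prod.mk.injEq] at hx
    obtain rfl : x = a := Fin.ext hx.1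
    exact hx.2.symm
  have hw : u' * u⁻¹ = (permGL K σ)⁻¹ * (b'⁻¹ * b) * permGL K σ := by
    have h3 : b'⁻¹ * b * permGL K σ = permGL K σ * (u' * u⁻¹) := by
      calc _ = (b'⁻¹ * b * permGL K σ * (u * u'⁻¹)) * (u' * u⁻¹) := by group
        _ = _ := by rw [← e1]
    rw [mul_assoc, h3, inv_mul_cancel_left]
  have hone : b'⁻¹ * b = 1 := by
    refine Units.ext (Matrix.ext fun i j => ?_)
    have h4 : (b'⁻¹ * b).val i j = (u' * u⁻¹).val (σ i) (σ j) := by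
      rw [hw]
      exact (permGL_conj_apply σ (b'⁻¹ * b).val i j).symm
    rcases lt_trichotomy i j with hij | rfl | hij
    · rw [h4, Units.val_one, Matrix.one_apply_ne hij.ne, Units.val_mul]
      refine (h'.lower.mul (inv_triangular _ h.lower)) ?_
      simpa using hij
    · have h5 : (u' * u⁻¹).val - 1 = (u'.val - 1) * u⁻¹.val + (u⁻¹.val - 1) := by
        rw [Units.val_mul, sub_mul, one_mul, sub_add_sub_cancel]
      have h6 : ((u' * u⁻¹).val - 1) (σ i) (σ i) = 0 := by
        rw [h5, Matrix.add_apply, strict_mul h'.unip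
          (unip_triangular (unip_inv _ h.unip)) _ _ le_rfl, unip_inv _ h.unip _ _ le_rfl, add_zero]
      rw [Matrix.sub_apply, sub_eq_zero] at h6
      rw [h4, h6, Units.val_one, Matrix.one_apply_eq, Matrix.one_apply_eq]
    · rw [hb (show j.val < i.val from hij), Units.val_one, Matrix.one_apply_ne hij.ne']
  obtain rfl : b' = b := inv_mul_eq_one.1 hone
  exact ⟨rfl, rfl, mul_left_cancel e⟩

end Bruhat

end MackeyLie

end
noncomputable section

namespace MackeyLie

attribute [local instance] LieRing.ofAssociativeRing

variable {k K : Type*} [Field k] [Field K] [Algebra k K] {m : ℕ}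

/-! ### From Bruhat decomposition and matching to representatives of double cosets -/

section Assembly

variable {G : LiePair k K m} {β β' : Fin m → ℕ}

theorem permGL_mem_levi {σ : Equiv.Perm (Fin m)} (hσ : permGL K σ ∈ G.grp)
    (h : ∀ a, β (σ a) = β a) : permGL K σ ∈ weyl G ⊓ (blockParabolic G β).levi.grp := by
  refine ⟨(mem_weyl_iff _).2 ⟨σ, rfl, hσ⟩, hσ, fun a b hab => ?_⟩
  rw [permGL_apply, if_neg]
  rintro rfl
  exact hab (h a).symm

/-- Mackey's formula for two block parabolics of a matrix group with a Bruhat decomposition. -/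
theorem mackey_of_bruhat [Finite K] (hβ : BlockClosed G β) (hβ' : BlockClosed G β')
    (hmono : Monotone β) (hmono' : Monotone β')
    (hcard : ∀ γ : Fin m → ℕ,
      Nat.card {g // g ∈ (blockParabolic G β').unip ∧ g.val.BlockTriangular γ} =
        Nat.card {X // X ∈ (blockParabolic G β').nil ∧ X.BlockTriangular γ})
    (hbruhat : ∀ g ∈ G.grp, ∃ b ∈ G.grp, ∃ w ∈ weyl G, ∃ u ∈ G.grp,
      b.val.BlockTriangular (fun a : Fin m => a.val) ∧
      u.val.BlockTriangular (fun a : Fin m => a.val) ∧ b * w * u = g)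
    (hmatch : ∀ σ τ : Equiv.Perm (Fin m), permGL K σ ∈ G.grp → permGL K τ ∈ G.grp →
      (∀ c, Nat.card {a // (β' a, β (σ a)) = c} = Nat.card {a // (β' a, β (τ a)) = c}) →
      ∃ ρ : Equiv.Perm (Fin m), permGL K ρ ∈ G.grp ∧
        ∀ a, (β' (ρ a), β (τ (ρ a))) = (β' a, β (σ a)))
    (R : Finset (GL (Fin m) K))
    (hR : IsDoubleCosetReps (weyl G) (weyl G ⊓ (blockParabolic G β').levi.grp)
      (weyl G ⊓ (blockParabolic G β).levi.grp) R) :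
    (blockParabolic G β').res ∘ₗ (blockParabolic G β).ind = ∑ w ∈ R,
      ((blockParabolic G β').rel (blockParabolic G β) w⁻¹).ind ∘ₗ
        ((blockParabolic G β).T (blockParabolic G β') w).toLinearMap ∘ₗ
        ((blockParabolic G β).rel (blockParabolic G β') w).res := by
  refine hβ.mackey hβ' hcard R hR.1 fun g hg => ?_
  have htri : ∀ {β : Fin m → ℕ}, Monotone β → ∀ X : Matrix (Fin m) (Fin m) K,
      X.BlockTriangular (fun a : Fin m => a.val) → X.BlockTriangular β :=
    fun hβ X hX a b hab => hX (not_le.1 fun h => hab.not_ge (hβ h))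
  have hmatch' : ∀ w₁ ∈ weyl G, ∀ w₂ ∈ weyl G, ∀ p' ∈ (blockParabolic G β').P,
      ∀ p ∈ (blockParabolic G β).P, w₂ = p' * w₁ * p →
      w₂ ∈ DoubleCoset.doubleCoset w₁
        ((weyl G ⊓ (blockParabolic G β').levi.grp : Subgroup _) : Set (GL (Fin m) K))
        ((weyl G ⊓ (blockParabolic G β).levi.grp : Subgroup _) : Set (GL (Fin m) K)) := by
    intro w₁ h₁ w₂ h₂ p' hp' p hp e
    obtain ⟨σ, rfl, hσ⟩ := (mem_weyl_iff w₁).1 h₁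
    obtain ⟨τ, rfl, hτ⟩ := (mem_weyl_iff w₂).1 h₂
    obtain ⟨ρ, hρ, hρ'⟩ := hmatch σ τ hσ hτ (card_cell_eq ((hβ'.mem_P_iff _).1 hp').2
      ((hβ.mem_P_iff _).1 hp).2 e)
    simp only [Prod.mk.injEq] at hρ'
    -- Multiplication of permutation matrices reverses composition, so w_τ = w_ρ⁻¹ · w_σ ·
    -- w_{τρσ⁻¹}; here ρ preserves `β'` and τρσ⁻¹ preserves `β`.
    refine (mem_doubleCoset_iff _ _ _ _).2 ⟨⟨_, inv_mem (permGL_mem_levi hρ fun a => (hρ' a).1)⟩,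
      ⟨permGL K (τ * ρ * σ⁻¹), permGL_mem_levi ?_ fun a => ?_⟩, ?_⟩
    · rw [← permGL_mul, ← permGL_mul, ← permGL_inv]
      exact mul_mem (inv_mem hσ) (mul_mem hρ hτ)
    · have h := (hρ' (σ⁻¹ a)).2
      simpa using h
    · change (permGL K ρ)⁻¹ * permGL K σ * permGL K (τ * ρ * σ⁻¹) = _
      rw [permGL_inv, permGL_mul, permGL_mul]
      congr 1
      group
  obtain ⟨b, hb, w, hw, u, hu, hb', hu', rfl⟩ := hbruhat g hg
  obtain ⟨r, ⟨hrR, hr⟩, -⟩ := hR.2 w hw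
  obtain ⟨l', l, e⟩ := (mem_doubleCoset_iff _ _ _ _).1 hr
  have hbP := (hβ'.mem_P_iff b).2 ⟨hb, htri hmono' _ hb'⟩
  have huP := (hβ.mem_P_iff u).2 ⟨hu, htri hmono _ hu'⟩
  have hl' := Parabolic.levi_le_P _ l'.2.2
  have hl := Parabolic.levi_le_P _ l.2.2
  refine ⟨r, ⟨hrR, (mem_doubleCoset_iff _ _ _ _).2 ⟨⟨_, mul_mem hbP (inv_mem hl')⟩,
    ⟨_, mul_mem (inv_mem hl) huP⟩, ?_⟩⟩, ?_⟩
  · dsimp only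
    rw [← e]
    group
  -- If g also lies in P'r'P, then r' ∈ P'rP; by `hmatch'` both represent the same double coset in
  -- W.
  · rintro r' ⟨hrR', hr'⟩
    obtain ⟨p', p, e'⟩ := (mem_doubleCoset_iff _ _ _ _).1 hr'
    obtain ⟨s, -, hs⟩ := hR.2 r (hR.1 r hrR)
    have h1 : r' ∈ DoubleCoset.doubleCoset r
        ((weyl G ⊓ (blockParabolic G β').levi.grp : Subgroup _) : Set (GL (Fin m) K))
        ((weyl G ⊓ (blockParabolic G β).levi.grp : Subgroup _) : Set (GL (Fin m) K)) := by
      refine hmatch' r (hR.1 r hrR) r' (hR.1 r' hrR') _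
        (mul_mem (mul_mem (inv_mem p'.2) hbP) (inv_mem hl')) _
        (mul_mem (mul_mem (inv_mem hl) huP) (inv_mem p.2)) ?_
      calc r' = p'.1⁻¹ * (p'.1 * r' * p.1) * p.1⁻¹ := by group
        _ = _ := by rw [e', ← e]; group
    exact (hs r' ⟨hrR', h1⟩).trans (hs r ⟨hrR, DoubleCoset.mem_doubleCoset_self _ _ _⟩).symm

end Assembly

/-! ### Invertibility of block diagonal parts and of scalar plus strictly triangular matrices -/

section DiagPartUnits

theorem exists_units_diagPart {β : Fin m → ℕ} (g : GL (Fin m) K)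
    (hg : g.val.BlockTriangular β) :
    ∃ l : GL (Fin m) K, l.val = diagPart β g.val ∧ l⁻¹.val = diagPart β g⁻¹.val := by
  have h := inv_triangular g hg
  refine ⟨⟨diagPart β g.val, diagPart β g⁻¹.val, ?_, ?_⟩, rfl, rfl⟩
  · rw [← diagPart_mul hg h, ← Units.val_mul, mul_inv_cancel, Units.val_one, diagPart_one]
  · rw [← diagPart_mul h hg, ← Units.val_mul, inv_mul_cancel, Units.val_one, diagPart_one]

variable {β : Fin m → ℕ}

/-- Used with c = 1 for 1 + X, X ∈ 𝔲, and with c = 2 for 1 + u = 2 + (u − 1), u ∈ U. -/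
theorem exists_units_add_strict (hmono : Monotone β) (c : K) (hc : c ≠ 0)
    (X : Matrix (Fin m) (Fin m) K) (hX : ∀ a b, β b ≤ β a → X a b = 0) :
    ∃ g : GL (Fin m) K, g.val = c • 1 + X := by
  refine exists_units_val_eq _ (fun a b hab => ?_) fun a => ?_
  · have hab : b < a := hab
    rw [Matrix.add_apply, Matrix.smul_apply, Matrix.one_apply_ne hab.ne', hX a b (hmono hab.le),
      smul_zero, add_zero]
  · rwa [Matrix.add_apply, Matrix.smul_apply, Matrix.one_apply_eq, hX a a le_rfl, smul_eq_mul,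
      mul_one, add_zero]

end DiagPartUnits

/-! ### Setting I: the general linear group -/

section GeneralLinear

theorem blockClosed_glPair (n : ℕ) (β : Fin n → ℕ) : BlockClosed (glPair K n) β where
  lie _ _ := LieSubalgebra.mem_top _
  grp g _ hg := by
    obtain ⟨l, hl, -⟩ := exists_units_diagPart g hg
    exact ⟨l, Subgroup.mem_top _, hl⟩

theorem card_unip_glPair (n : ℕ) {β : Fin n → ℕ} (hmono : Monotone β) (γ : Fin n → ℕ) :
    Nat.card {g // g ∈ (blockParabolic (glPair K n) β).unip ∧ g.val.BlockTriangular γ} =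
      Nat.card {X // X ∈ (blockParabolic (glPair K n) β).nil ∧ X.BlockTriangular γ} := by
  refine Nat.card_eq_of_bijective (fun g => ⟨g.1.val - 1, ⟨LieSubalgebra.mem_top _,
    unip_iff.1 g.2.1.2⟩, g.2.2.sub Matrix.blockTriangular_one⟩) ⟨fun g h e => ?_, ?_⟩
  · exact Subtype.ext (Units.ext (sub_left_injective (congrArg Subtype.val e)))
  · rintro ⟨X, hX, hX'⟩
    obtain ⟨g, hg⟩ := exists_units_add_strict hmono 1 one_ne_zero X hX.2
    rw [one_smul] at hg
    have e : g.val - 1 = X := by rw [hg, add_sub_cancel_left]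
    refine ⟨⟨g, ⟨Subgroup.mem_top _, unip_iff.2 (e ▸ hX.2)⟩, ?_⟩, Subtype.ext e⟩
    rw [hg]
    exact Matrix.blockTriangular_one.add hX'

theorem monotone_glBlock (n i : ℕ) : Monotone (glBlock n i) := by
  intro a b hab
  have : a.val ≤ b.val := hab
  unfold glBlock
  split_ifs <;> omega

theorem mackey_glParabolic (K : Type*) [Field K] [Finite K] (n i i' : ℕ)
    (R : Finset (GL (Fin n) K))
    (hR : IsDoubleCosetReps (weyl (glPair K n)) (weyl (glPair K n) ⊓ (glParabolic K n i').levi.grp)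
      (weyl (glPair K n) ⊓ (glParabolic K n i).levi.grp) R) :
    (glParabolic K n i').res ∘ₗ (glParabolic K n i).ind = ∑ w ∈ R,
      ((glParabolic K n i').rel (glParabolic K n i) w⁻¹).ind ∘ₗ
        ((glParabolic K n i).T (glParabolic K n i') w).toLinearMap ∘ₗ
        ((glParabolic K n i).rel (glParabolic K n i') w).res := by
  refine mackey_of_bruhat (blockClosed_glPair n _) (blockClosed_glPair n _) (monotone_glBlock n i)
    (monotone_glBlock n i') (card_unip_glPair n (monotone_glBlock n i')) ?_ ?_ R hR
  · intro g _
    obtain ⟨b, σ, u, h, e⟩ := exists_bruhat g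
    exact ⟨b, Subgroup.mem_top _, _, (mem_weyl_iff _).2 ⟨σ, rfl, Subgroup.mem_top _⟩, u,
      Subgroup.mem_top _, h.left, unip_triangular h.unip, e⟩
  · intro σ τ _ _ h
    obtain ⟨ρ, hρ⟩ := exists_perm_comp_eq _ _ h
    exact ⟨ρ, Subgroup.mem_top _, hρ⟩

end GeneralLinear

/-! ### The Cayley transform -/

section Cayley

/-- The Cayley transform `(1 - A) (1 + A)⁻¹`. -/
def cayley (A : Matrix (Fin m) (Fin m) K) : Matrix (Fin m) (Fin m) K := (1 - A) * (1 + A)⁻¹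

theorem cayley_eq (A : Matrix (Fin m) (Fin m) K) (g : GL (Fin m) K) (hg : g.val = 1 + A) :
    cayley A = (1 - A) * g⁻¹.val := by
  rw [cayley, ← hg, Matrix.coe_units_inv]

theorem cayley_cayley (A : Matrix (Fin m) (Fin m) K) (g : GL (Fin m) K) (hg : g.val = 1 + A)
    (h2 : (2 : K) ≠ 0) : cayley (cayley A) = A := by
  have h1 : g.val * g⁻¹.val = 1 := by rw [← Units.val_mul, mul_inv_cancel, Units.val_one]
  have h1' : g⁻¹.val * g.val = 1 := by rw [← Units.val_mul, inv_mul_cancel, Units.val_one]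
  have e1 : 1 + cayley A = (2 : K) • g⁻¹.val := by
    rw [cayley_eq A g hg]
    calc 1 + (1 - A) * g⁻¹.val = g.val * g⁻¹.val + (1 - A) * g⁻¹.val := by rw [h1]
      _ = _ := by rw [← add_mul, hg, add_add_sub_cancel, ← two_mul, mul_one, two_smul, two_mul]
  have e2 : 1 - cayley A = (2 : K) • (A * g⁻¹.val) := by
    rw [cayley_eq A g hg]
    calc 1 - (1 - A) * g⁻¹.val = g.val * g⁻¹.val - (1 - A) * g⁻¹.val := by rw [h1]
      _ = _ := by rw [← sub_mul, hg, add_sub_sub_cancel, add_mul, two_smul]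
  have e3 : (1 + cayley A) * ((2 : K)⁻¹ • g.val) = 1 := by
    rw [e1, smul_mul_smul_comm, mul_inv_cancel₀ h2, h1', one_smul]
  rw [cayley, Matrix.inv_eq_right_inv e3, e2, smul_mul_smul_comm, mul_inv_cancel₀ h2, one_smul,
    mul_assoc, h1', mul_one]

theorem cayley_mul_cayley_neg (A : Matrix (Fin m) (Fin m) K) (g h : GL (Fin m) K)
    (hg : g.val = 1 + A) (hh : h.val = 1 - A) : cayley A * cayley (-A) = 1 := by
  rw [cayley_eq A g hg, cayley_eq (-A) h (by rw [hh, sub_eq_add_neg]), sub_neg_eq_add, ← hg, ← hh,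
    mul_assoc, ← mul_assoc g⁻¹.val, ← Units.val_mul, inv_mul_cancel, Units.val_one, one_mul,
    ← Units.val_mul, mul_inv_cancel, Units.val_one]

theorem cayley_blockTriangular (A : Matrix (Fin m) (Fin m) K) (g : GL (Fin m) K)
    (hg : g.val = 1 + A) {γ : Fin m → ℕ} (hA : A.BlockTriangular γ) :
    (cayley A).BlockTriangular γ := by
  rw [cayley_eq A g hg]
  refine (Matrix.blockTriangular_one.sub hA).mul (inv_triangular g ?_)
  rw [hg]
  exact Matrix.blockTriangular_one.add hA

end Cayley

/-! ### Setting II: the unitary group -/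

section Unitary

variable (k)

/-- The involutive anti-automorphism `X ↦ J X^* J`. -/
def adjoint [Fintype k] (X : Matrix (Fin m) (Fin m) K) : Matrix (Fin m) (Fin m) K :=
  Matrix.of fun a b => FiniteField.frobeniusAlgHom k K (X b.rev a.rev)

variable [Fintype k]

theorem adjoint_apply (X : Matrix (Fin m) (Fin m) K) (a b : Fin m) :
    adjoint k X a b = FiniteField.frobeniusAlgHom k K (X b.rev a.rev) := rfl

theorem adjoint_mul (X Y : Matrix (Fin m) (Fin m) K) :
    adjoint k (X * Y) = adjoint k Y * adjoint k X := by
  refine Matrix.ext fun a b => ?_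
  rw [adjoint_apply, Matrix.mul_apply, Matrix.mul_apply, map_sum, ← Equiv.sum_comp Fin.revPerm]
  refine Finset.sum_congr rfl fun c _ => ?_
  rw [map_mul, mul_comm]
  rfl

theorem adjoint_one : adjoint k (1 : Matrix (Fin m) (Fin m) K) = 1 := by
  refine Matrix.ext fun a b => ?_
  rw [adjoint_apply, Matrix.one_apply, Matrix.one_apply, apply_ite (FiniteField.frobeniusAlgHom k K),
    map_one, map_zero]
  simp only [Fin.rev_inj, eq_comm]

theorem adjoint_add (X Y : Matrix (Fin m) (Fin m) K) :
    adjoint k (X + Y) = adjoint k X + adjoint k Y :=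
  Matrix.ext fun _ _ => map_add (FiniteField.frobeniusAlgHom k K) _ _

theorem adjoint_sub (X Y : Matrix (Fin m) (Fin m) K) :
    adjoint k (X - Y) = adjoint k X - adjoint k Y :=
  Matrix.ext fun _ _ => map_sub (FiniteField.frobeniusAlgHom k K) _ _

/-- The automorphism `g ↦ J (g^*)⁻¹ J` of `GL(m, K)`. -/
def twist : GL (Fin m) K →* GL (Fin m) K where
  toFun g := ⟨adjoint k g⁻¹.val, adjoint k g.val,
    by rw [← adjoint_mul, ← Units.val_mul, mul_inv_cancel, Units.val_one, adjoint_one],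
    by rw [← adjoint_mul, ← Units.val_mul, inv_mul_cancel, Units.val_one, adjoint_one]⟩
  map_one' := Units.ext (by
    change adjoint k (1⁻¹ : GL (Fin m) K).val = 1
    rw [inv_one, Units.val_one, adjoint_one])
  map_mul' g h := Units.ext (by
    change adjoint k (g * h)⁻¹.val = adjoint k g⁻¹.val * adjoint k h⁻¹.val
    rw [mul_inv_rev, Units.val_mul, adjoint_mul])

theorem twist_val (g : GL (Fin m) K) : (twist k g).val = adjoint k g⁻¹.val := rfl

theorem twist_inv_val (g : GL (Fin m) K) : (twist k g)⁻¹.val = adjoint k g.val := rfl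

theorem conjTr_mul_J_apply (X : Matrix (Fin m) (Fin m) K) (a b : Fin m) :
    (conjTr k X * J K m) a b = adjoint k X a.rev b := by
  simp [conjTr_eq, J, Matrix.mul_apply, adjoint_apply, Fin.rev_eq_iff, eq_comm (a := b)]

theorem J_mul_apply (X : Matrix (Fin m) (Fin m) K) (a b : Fin m) :
    (J K m * X) a b = X a.rev b := by
  simp [J, Matrix.mul_apply]

theorem mem_unitary_iff (g : GL (Fin m) K) :
    g ∈ (unitaryPair k K m).grp ↔ adjoint k g.val = g⁻¹.val := by
  have h : g ∈ (unitaryPair k K m).grp ↔ conjTr k g.val * J K m = J K m * g⁻¹.val := by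
    refine ⟨unitary_comm k K g, fun h => ?_⟩
    change conjTr k g.val * J K m * g.val = J K m
    rw [h, mul_assoc, ← Units.val_mul, inv_mul_cancel, Units.val_one, mul_one]
  rw [h, ← Matrix.ext_iff, ← Matrix.ext_iff]
  simp only [conjTr_mul_J_apply, J_mul_apply]
  exact ⟨fun h a b => by simpa using h a.rev b, fun h a b => h _ _⟩

theorem mem_unitary_iff_twist (g : GL (Fin m) K) :
    g ∈ (unitaryPair k K m).grp ↔ twist k g = g := by
  rw [mem_unitary_iff, ← twist_inv_val, ← Units.ext_iff, inv_inj]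

theorem mem_unitary_lie_iff (X : Matrix (Fin m) (Fin m) K) :
    X ∈ (unitaryPair k K m).lie ↔ adjoint k X = -X := by
  change conjTr k X * J K m + J K m * X = 0 ↔ _
  rw [← Matrix.ext_iff, ← Matrix.ext_iff]
  simp only [Matrix.add_apply, conjTr_mul_J_apply, J_mul_apply, Matrix.zero_apply,
    add_eq_zero_iff_eq_neg, Matrix.neg_apply]
  exact ⟨fun h a b => by simpa using h a.rev b, fun h a b => h _ _⟩

variable {k}

/-- The hypothesis says that reversal of indices permutes the blocks, so it respects the condition
of lying in a diagonal block. -/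
theorem adjoint_diagPart {β : Fin m → ℕ} (hβ : ∀ a b : Fin m, β a.rev = β b.rev ↔ β a = β b)
    (X : Matrix (Fin m) (Fin m) K) : adjoint k (diagPart β X) = diagPart β (adjoint k X) := by
  refine Matrix.ext fun a b => ?_
  rw [adjoint_apply, diagPart_apply, diagPart_apply, apply_ite (FiniteField.frobeniusAlgHom k K),
    map_zero, adjoint_apply]
  simp only [hβ, eq_comm]

theorem diagPart_neg (β : Fin m → ℕ) (X : Matrix (Fin m) (Fin m) K) :
    diagPart β (-X) = -diagPart β X := by
  refine Matrix.ext fun a b => ?_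
  rw [Matrix.neg_apply, diagPart_apply, diagPart_apply, Matrix.neg_apply]
  split_ifs <;> simp

theorem blockClosed_unitaryPair {β : Fin m → ℕ}
    (hβ : ∀ a b : Fin m, β a.rev = β b.rev ↔ β a = β b) :
    BlockClosed (unitaryPair k K m) β where
  lie X hX := by
    rw [mem_unitary_lie_iff] at hX ⊢
    rw [adjoint_diagPart hβ, hX, diagPart_neg]
  grp g hg hg' := by
    obtain ⟨l, hl, hl'⟩ := exists_units_diagPart g hg'
    refine ⟨l, ?_, hl⟩
    rw [mem_unitary_iff] at hg ⊢
    rw [hl, hl', adjoint_diagPart hβ, hg]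

/-- The adjoint interchanges 1 + X and 1 − X, and these commute. -/
theorem adjoint_cayley_of_lie (X : Matrix (Fin m) (Fin m) K) (g h : GL (Fin m) K)
    (hg : g.val = 1 + X) (hh : h.val = 1 - X) (hX : adjoint k X = -X) :
    adjoint k (cayley X) = cayley (-X) := by
  have h1 : twist k g = h⁻¹ := by
    rw [← inv_inj, inv_inv]
    refine Units.ext ?_
    rw [twist_inv_val, hg, hh, adjoint_add, adjoint_one, hX, sub_eq_add_neg]
  rw [cayley_eq X g hg, adjoint_mul, ← twist_val, h1, adjoint_sub, adjoint_one, hX,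
    cayley_eq (-X) h (by rw [hh, sub_eq_add_neg]), sub_neg_eq_add, ← hg]
  have h2 : Commute h g := Units.ext (by rw [Units.val_mul, Units.val_mul, hg, hh]; noncomm_ring)
  rw [← Units.val_mul, ← Units.val_mul, h2.inv_left.eq]

/-- The adjoint of 1 + u is 1 + u⁻¹ = u⁻¹(1 + u); the factor u turns u⁻¹ − 1 into 1 − u up to sign.
-/
theorem adjoint_cayley_of_grp (u g : GL (Fin m) K) (hg : g.val = 1 + u.val)
    (hu : adjoint k u.val = u⁻¹.val) : adjoint k (cayley u.val) = -cayley u.val := by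
  have h1 : twist k g = g⁻¹ * u := by
    have h2 : (twist k g)⁻¹ = u⁻¹ * g := by
      refine Units.ext ?_
      rw [twist_inv_val, hg, adjoint_add, adjoint_one, hu, Units.val_mul, hg, mul_add, mul_one,
        ← Units.val_mul, inv_mul_cancel, Units.val_one, add_comm]
    rw [← inv_inv (twist k g), h2, mul_inv_rev, inv_inv]
  have h3 : Commute g.val (u.val - 1) := by
    rw [hg]
    exact (Commute.one_left _).add_left ((Commute.refl _).sub_right (Commute.one_right _))
  rw [cayley_eq u.val g hg, adjoint_mul, ← twist_val, h1, adjoint_sub, adjoint_one, hu,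
    Units.val_mul, mul_assoc, mul_sub, mul_one, ← Units.val_mul u, mul_inv_cancel, Units.val_one,
    h3.units_inv_left.eq, ← neg_mul, neg_sub]

/-- The map g ↦ g − 1 does not respect the unitary condition, but the Cayley transform does. It is
its own inverse, exchanges unipotent and nilpotent elements, and preserves triangularity for every
`γ`. -/
theorem card_unip_unitaryPair {β : Fin m → ℕ} (h2 : (2 : K) ≠ 0) (hmono : Monotone β)
    (γ : Fin m → ℕ) :
    Nat.card {g // g ∈ (blockParabolic (unitaryPair k K m) β).unip ∧ g.val.BlockTriangular γ} =
      Nat.card {X // X ∈ (blockParabolic (unitaryPair k K m) β).nil ∧ X.BlockTriangular γ} := by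
  have hunip : ∀ g ∈ (blockParabolic (unitaryPair k K m) β).unip,
      ∃ p : GL (Fin m) K, p.val = 1 + g.val := by
    intro g hg
    obtain ⟨p, hp⟩ := exists_units_add_strict hmono 2 h2 (g.val - 1) (unip_iff.1 hg.2)
    exact ⟨p, by rw [hp, two_smul]; abel⟩
  have hnil : ∀ X : Matrix (Fin m) (Fin m) K, (∀ a b, β b ≤ β a → X a b = 0) →
      ∃ p : GL (Fin m) K, p.val = 1 + X := by
    intro X hX
    obtain ⟨p, hp⟩ := exists_units_add_strict hmono 1 one_ne_zero X hX
    exact ⟨p, by rw [hp, one_smul]⟩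
  refine Nat.card_eq_of_bijective (fun g => ⟨cayley g.1.val, ⟨?_, ?_⟩, ?_⟩) ⟨?_, ?_⟩
  · obtain ⟨p, hp⟩ := hunip g.1 g.2.1
    exact (mem_unitary_lie_iff k _).2
      (adjoint_cayley_of_grp g.1 p hp ((mem_unitary_iff k _).1 g.2.1.1))
  · obtain ⟨p, hp⟩ := hunip g.1 g.2.1
    have h := unip_iff.1 g.2.1.2
    intro a b hab
    rw [cayley_eq _ p hp, ← neg_sub, neg_mul, Matrix.neg_apply, strict_mul h
      (inv_triangular p ?_) a b hab, neg_zero]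
    rw [hp]
    exact Matrix.blockTriangular_one.add (unip_triangular h)
  · obtain ⟨p, hp⟩ := hunip g.1 g.2.1
    exact cayley_blockTriangular _ p hp g.2.2
  · rintro ⟨g, hg⟩ ⟨h, hh⟩ e
    have e : cayley g.val = cayley h.val := congrArg Subtype.val e
    obtain ⟨p, hp⟩ := hunip g hg.1
    obtain ⟨p', hp'⟩ := hunip h hh.1
    refine Subtype.ext (Units.ext ?_)
    change g.val = h.val
    rw [← cayley_cayley g.val p hp h2, e, cayley_cayley h.val p' hp' h2]
  · rintro ⟨X, hX, hXγ⟩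
    have hX' : ∀ a b, β b ≤ β a → (-X) a b = 0 := fun a b hab => by
      rw [Matrix.neg_apply, hX.2 a b hab, neg_zero]
    obtain ⟨p, hp⟩ := hnil X hX.2
    obtain ⟨q, hq⟩ := hnil (-X) hX'
    have hq' : q.val = 1 - X := by rw [hq, sub_eq_add_neg]
    have hlie := (mem_unitary_lie_iff k X).1 hX.1
    let g : GL (Fin m) K := ⟨cayley X, cayley (-X), cayley_mul_cayley_neg X p q hp hq', by
      have := cayley_mul_cayley_neg (-X) q p hq (by rw [hp, sub_neg_eq_add])
      rwa [neg_neg] at this⟩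
    refine ⟨⟨g, ⟨(mem_unitary_iff k g).2 (adjoint_cayley_of_lie X p q hp hq' hlie),
      unip_iff.2 fun a b hab => ?_⟩, cayley_blockTriangular X p hp hXγ⟩,
      Subtype.ext (cayley_cayley X p hp h2)⟩
    have e : cayley X - 1 = -((2 : K) • (X * p⁻¹.val)) := by
      have h1 : p.val * p⁻¹.val = 1 := by rw [← Units.val_mul, mul_inv_cancel, Units.val_one]
      calc cayley X - 1 = (1 - X) * p⁻¹.val - p.val * p⁻¹.val := by rw [cayley_eq X p hp, h1]
        _ = _ := by
          rw [← sub_mul, hp, two_smul, ← add_mul, ← neg_mul]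
          congr 1
          abel
    change (cayley X - 1) a b = 0
    rw [e, Matrix.neg_apply, Matrix.smul_apply, strict_mul hX.2 (inv_triangular p ?_) a b hab,
      smul_zero, neg_zero]
    rw [hp]
    exact Matrix.blockTriangular_one.add (strict_triangular hX.2)

theorem twist_permGL (σ : Equiv.Perm (Fin m)) :
    twist k (permGL K σ) = permGL K (Fin.revPerm * σ * Fin.revPerm) := by
  refine Units.ext (Matrix.ext fun a b => ?_)
  rw [twist_val, adjoint_apply, permGL_inv, permGL_apply, permGL_apply,
    apply_ite (FiniteField.frobeniusAlgHom k K), map_one, map_zero]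
  congr 1
  rw [Equiv.Perm.inv_eq_iff_eq, eq_iff_iff]
  change b.rev = σ a.rev ↔ (σ a.rev).rev = b
  exact ⟨fun h => by rw [← h, Fin.rev_rev], fun h => by rw [← h, Fin.rev_rev]⟩

/-- Transposing and reversing the indices is reflection in the antidiagonal, which preserves upper
and lower triangularity. -/
theorem IsBruhat.twist {b u : GL (Fin m) K} {σ : Equiv.Perm (Fin m)} (h : IsBruhat b σ u) :
    IsBruhat (twist k b) (Fin.revPerm * σ * Fin.revPerm) (MackeyLie.twist k u) where
  left a c hac := by
    rw [twist_val, adjoint_apply, inv_triangular _ h.left, map_zero]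
    exact Fin.rev_lt_rev.2 hac
  unip a c hac := by
    rw [twist_val, ← adjoint_one k, ← adjoint_sub, adjoint_apply, unip_inv _ h.unip, map_zero]
    exact Fin.rev_le_rev.2 hac
  lower a c hac := by
    rw [twist_val, adjoint_apply, inv_triangular _ h.lower, map_zero]
    exact Fin.rev_lt_rev.1 hac

theorem permGL_injective : Function.Injective (permGL K : Equiv.Perm (Fin m) → GL (Fin m) K) := by
  intro σ τ h
  refine Equiv.ext fun a => ?_
  have h1 : (permGL K τ).val a (σ a) = 1 := by rw [← h, permGL_apply, if_pos rfl]
  rw [permGL_apply] at h1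
  exact (by_contra fun hne => zero_ne_one (α := K) (by rwa [if_neg hne] at h1) : τ a = σ a).symm

theorem permGL_mem_unitary_iff (σ : Equiv.Perm (Fin m)) :
    permGL K σ ∈ (unitaryPair k K m).grp ↔ ∀ a, σ a.rev = (σ a).rev := by
  rw [mem_unitary_iff_twist, twist_permGL, permGL_injective.eq_iff, Equiv.ext_iff]
  refine forall_congr' fun a => ?_
  change (σ a.rev).rev = σ a ↔ _
  rw [Fin.rev_eq_iff]

/-- The twist of the refined decomposition of g is again a refined decomposition of the same g, so
by uniqueness all three factors are fixed by the twist. -/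
theorem exists_bruhat_unitary (g : GL (Fin m) K) (hg : g ∈ (unitaryPair k K m).grp) :
    ∃ b ∈ (unitaryPair k K m).grp, ∃ w ∈ weyl (unitaryPair k K m),
      ∃ u ∈ (unitaryPair k K m).grp, b.val.BlockTriangular (fun a : Fin m => a.val) ∧
      u.val.BlockTriangular (fun a : Fin m => a.val) ∧ b * w * u = g := by
  obtain ⟨b, σ, u, h, e⟩ := exists_bruhat g
  have e' : twist k b * permGL K (Fin.revPerm * σ * Fin.revPerm) * twist k u =
      b * permGL K σ * u := by
    rw [← twist_permGL (k := k), ← map_mul, ← map_mul, e, (mem_unitary_iff_twist k g).1 hg]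
  obtain ⟨h1, h2, h3⟩ := (h.twist (k := k)).unique h e'
  refine ⟨b, (mem_unitary_iff_twist k b).2 h1, permGL K σ, (mem_weyl_iff _).2 ⟨σ, rfl,
    (mem_unitary_iff_twist k _).2 ?_⟩, u, (mem_unitary_iff_twist k u).2 h3, h.left,
    unip_triangular h.unip, e⟩
  rw [twist_permGL, h2]

theorem monotone_unitaryBlock (i j m : ℕ) : Monotone (unitaryBlock i j m) := by
  intro a b hab
  have : a.val ≤ b.val := hab
  unfold unitaryBlock
  split_ifs <;> omega

theorem unitaryBlock_rev {n i j : ℕ} (h : i + j = n) (a : Fin (2 * n)) :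
    unitaryBlock i j (2 * n) a.rev = Equiv.swap 0 2 (unitaryBlock i j (2 * n) a) := by
  have ha := a.2
  unfold unitaryBlock
  rw [Fin.val_rev]
  split_ifs <;> first | omega | rfl

theorem mackey_unitaryParabolic (k K : Type*) [Field k] [Fintype k] [Field K] [Finite K]
    [Algebra k K] (hk : Odd (Fintype.card k)) (n i j i' j' : ℕ) (hij : i + j = n)
    (hij' : i' + j' = n) (R : Finset (GL (Fin (2 * n)) K))
    (hR : IsDoubleCosetReps (weyl (unitaryPair k K (2 * n)))
      (weyl (unitaryPair k K (2 * n)) ⊓ (unitaryParabolic k K n i' j').levi.grp)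
      (weyl (unitaryPair k K (2 * n)) ⊓ (unitaryParabolic k K n i j).levi.grp) R) :
    (unitaryParabolic k K n i' j').res ∘ₗ (unitaryParabolic k K n i j).ind = ∑ w ∈ R,
      ((unitaryParabolic k K n i' j').rel (unitaryParabolic k K n i j) w⁻¹).ind ∘ₗ
        ((unitaryParabolic k K n i j).T (unitaryParabolic k K n i' j') w).toLinearMap ∘ₗ
        ((unitaryParabolic k K n i j).rel (unitaryParabolic k K n i' j') w).res := by
  have h2 : (2 : K) ≠ 0 := by
    have h : (2 : k) ≠ 0 := Ring.two_ne_zero fun h => by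
      have := FiniteField.even_card_iff_char_two.1 h
      have := Nat.odd_iff.1 hk
      omega
    have h' := (map_ne_zero (algebraMap k K)).2 h
    rwa [map_ofNat] at h'
  have hclosed : ∀ {i j : ℕ}, i + j = n →
      BlockClosed (unitaryPair k K (2 * n)) (unitaryBlock i j (2 * n)) := fun h =>
    blockClosed_unitaryPair fun a b => by
      rw [unitaryBlock_rev h, unitaryBlock_rev h, Equiv.apply_eq_iff_eq]
  refine mackey_of_bruhat (hclosed hij) (hclosed hij') (monotone_unitaryBlock _ _ _)
    (monotone_unitaryBlock _ _ _) (card_unip_unitaryPair h2 (monotone_unitaryBlock _ _ _))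
    exists_bruhat_unitary ?_ R hR
  intro σ τ hσ hτ h
  rw [permGL_mem_unitary_iff] at hσ hτ
  -- A fixed index would satisfy 2a + 1 = 2n.
  have hfix : ∀ a : Fin (2 * n), Fin.revPerm a ≠ a := fun a ha => by
    have h1 : a.rev.val = a.val := congrArg Fin.val ha
    rw [Fin.val_rev] at h1
    have := a.2
    omega
  -- Reversal exchanges the outer blocks 0 and 2 and fixes block 1. As σ and τ commute with it, both
  -- colourings by pairs of block numbers are equivariant.
  obtain ⟨ρ, hρ, hρ'⟩ := exists_commuting_perm_comp_eq Fin.revPerm Fin.rev_rev hfix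
    (Prod.map (Equiv.swap 0 2) (Equiv.swap 0 2))
    (fun x => Prod.ext (Equiv.swap_apply_self _ _ _) (Equiv.swap_apply_self _ _ _))
    _ (fun a => Prod.ext (unitaryBlock_rev hij' a)
      ((congrArg _ (hσ a)).trans (unitaryBlock_rev hij _)))
    _ (fun a => Prod.ext (unitaryBlock_rev hij' a)
      ((congrArg _ (hτ a)).trans (unitaryBlock_rev hij _))) h
  exact ⟨ρ, (permGL_mem_unitary_iff ρ).2 hρ, hρ'⟩

end Unitary

end MackeyLie

end

theorem theorem1 :
    (∀ (K : Type*) [Field K] [Finite K] (n i i' : ℕ), i ≤ n → i' ≤ n →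
      ∀ R : Finset (GL (Fin n) K),
      MackeyLie.IsDoubleCosetReps (MackeyLie.weyl (MackeyLie.glPair K n))
        (MackeyLie.weyl (MackeyLie.glPair K n) ⊓ (MackeyLie.glParabolic K n i').levi.grp)
        (MackeyLie.weyl (MackeyLie.glPair K n) ⊓ (MackeyLie.glParabolic K n i).levi.grp) R →
      (MackeyLie.glParabolic K n i').res ∘ₗ (MackeyLie.glParabolic K n i).ind =
        ∑ w ∈ R,
          ((MackeyLie.glParabolic K n i').rel (MackeyLie.glParabolic K n i) w⁻¹).ind ∘ₗ
            ((MackeyLie.glParabolic K n i).T (MackeyLie.glParabolic K n i') w).toLinearMap ∘ₗ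
            ((MackeyLie.glParabolic K n i).rel (MackeyLie.glParabolic K n i') w).res) ∧
    (∀ (k K : Type*) [Field k] [Fintype k] [Field K] [Finite K] [Algebra k K],
      Odd (Fintype.card k) → Module.finrank k K = 2 →
      ∀ n i j i' j' : ℕ, i + j = n → i' + j' = n →
      ∀ R : Finset (GL (Fin (2 * n)) K),
      MackeyLie.IsDoubleCosetReps (MackeyLie.weyl (MackeyLie.unitaryPair k K (2 * n)))
        (MackeyLie.weyl (MackeyLie.unitaryPair k K (2 * n)) ⊓
          (MackeyLie.unitaryParabolic k K n i' j').levi.grp)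
        (MackeyLie.weyl (MackeyLie.unitaryPair k K (2 * n)) ⊓
          (MackeyLie.unitaryParabolic k K n i j).levi.grp) R →
      (MackeyLie.unitaryParabolic k K n i' j').res ∘ₗ (MackeyLie.unitaryParabolic k K n i j).ind =
        ∑ w ∈ R,
          ((MackeyLie.unitaryParabolic k K n i' j').rel
            (MackeyLie.unitaryParabolic k K n i j) w⁻¹).ind ∘ₗ
            ((MackeyLie.unitaryParabolic k K n i j).T
              (MackeyLie.unitaryParabolic k K n i' j') w).toLinearMap ∘ₗ
            ((MackeyLie.unitaryParabolic k K n i j).rel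
              (MackeyLie.unitaryParabolic k K n i' j') w).res) :=
  ⟨fun K _ _ n i i' _ _ R hR => MackeyLie.mackey_glParabolic K n i i' R hR,
    fun k K _ _ _ _ _ hk _ n i j i' j' hij hij' R hR =>
      MackeyLie.mackey_unitaryParabolic k K hk n i j i' j' hij hij' R hR⟩
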